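/- Let $\Lambda\ge 1$ be an integer photon cutoff, let $a$ be the $(\Lambda+1)\times(\Lambda+1)$ truncated annihilation operator, $a|n\rangle=\sqrt n\,|n-1\rangle$ for $0\le n\le\Lambda$, and let $a^\dagger$ be its adjoint. For an integer $k\ge 0$ and real $t$ put $$\mathcal S_k(t)=\exp\left(it\begin{bmatrix}0&(a^\dagger)^k\\ a^k&0\end{bmatrix}\right),$$ a unitary on one qubit tensored with the truncated mode. Norms are operator norms. **The algorithm ADD.** Let $p_l,p_r\ge 1$ be real and $q=\max\left(\left\lceil\frac{\min(p_l,p_r)-1}{2}\right\rceil,1\right)$. Let $X,S=\mathrm{diag}(1,i),H$ be the qubit gates. Let $\widetilde{\mathcal S}_l(t),\widetilde{\mathcal S}_r(t)$ $(t>0)$ be unitaries, extended to negative times by $\widetilde{\mathcal S}(-t)=\widetilde{\mathcal S}(t)^{-1}$. For families $U(t),V(t)$ define $\mathrm{BCH}_1(U,V)(t)=U(t)V(t)U(-t)V(-t)$ and, writing $F=\mathrm{BCH}_p(U,V)$, $$\mathrm{BCH}_{p+1}(U,V)(t)=F(\gamma_pt)F(-\gamma_pt)F(\beta_pt)^{-1}F(-\beta_pt)^{-1}F(\gamma_pt)F(-\gamma_pt),$$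 $\beta_p=\sqrt{2r_p}$, $\gamma_p=\sqrt{\tfrac14+r_p}$, $r_p=\frac{2^{1/(p+1)}}{4(2-2^{1/(p+1)})}$. Define $\mathrm{Trotter}_2(U,V)(t)=U(\tfrac t2)V(\tfrac t2)V(\tfrac t2)U(\tfrac t2)$ and, for $k\ge 2$, with $T=\mathrm{Trotter}_{2k-2}(U,V)$ and $\pi_k=(4-4^{1/(2k-1)})^{-1}$, $\mathrm{Trotter}_{2k}(U,V)(t)=T(\pi_kt)^2\,T((1-4\pi_k)t)\,T(\pi_kt)^2$. For $t\ge 0$ and $\tau=\sqrt{t/2}$ put $$L(t)=SH\,\mathrm{BCH}_q(X\widetilde{\mathcal S}_rX,\widetilde{\mathcal S}_l)(\tau)\,HS^\dagger,\qquad R(t)=H\,\mathrm{BCH}_q(S\widetilde{\mathcal S}_lS^\dagger,X\widetilde{\mathcal S}_rX)(\tau)\,H,$$ with $L(-t)=L(t)^{-1}$, $R(-t)=R(t)^{-1}$. The output of ADD is $\widetilde{\mathcal S}(t)=X\,\mathrm{Trotter}_{2q}(L,R)(t)\,X$. **Statement.** For all real $p_l,p_r\ge 1$: 1. For every $t>0$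 the circuit $\widetilde{\mathcal S}(t)$ uses in total at most $1.07\cdot 30^q$ of the constituent operators $\widetilde{\mathcal S}_l,\widetilde{\mathcal S}_r$ and their inverses. 2. For all $K,\delta>0$ there are $K',\delta'>0$, depending only on $p_l,p_r,K,\delta$, such that the following holds for all integers $\Lambda\ge1$, $k_l,k_r\ge0$, all real $c\ge\Lambda^{\max(k_l,k_r)/2}$, and all families of unitaries $\widetilde{\mathcal S}_l,\widetilde{\mathcal S}_r$. If $$\|\widetilde{\mathcal S}_l(t)-\mathcal S_{k_l}(t)\|\le K(ct)^{p_l},\qquad \|\widetilde{\mathcal S}_r(t)-\mathcal S_{k_r}(t)\|\le K(ct)^{p_r}\qquad\text{whenever } t>0,\ ct\le\delta,$$ then $$\|\widetilde{\mathcal S}(t)-\mathcal S_{k_l+k_r}(t)\|\le K'(c^2t)^{\min(p_l,p_r)/2}\qquad\text{whenever } t>0,\ c^2t\le\delta'.$$ -/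

import Mathlib

open scoped Matrix Matrix.Norms.L2Operator

noncomputable section

namespace HybridAdder

/-- Operators on one qubit tensored with a bosonic mode with at most `Λ` photons, as `2 × 2` block
matrices: the first summand belongs to the qubit state `0`, the second one to the state `1`. -/
abbrev Op (Λ : ℕ) := Matrix (Fin (Λ + 1) ⊕ Fin (Λ + 1)) (Fin (Λ + 1) ⊕ Fin (Λ + 1)) ℂ

/-- The annihilation operator with photon cutoff `Λ`: it sends the number state `n` to `√n` times
the number state `n - 1`. The creation operator is its adjoint `(annihilation Λ)ᴴ`. -/
def annihilation (Λ : ℕ) : Matrix (Fin (Λ + 1)) (Fin (Λ + 1)) ℂ :=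
  Matrix.of fun m n => if (m : ℕ) + 1 = (n : ℕ) then ((Real.sqrt (n : ℕ) : ℝ) : ℂ) else 0

/-- The ideal gate `S_k(t) = exp (i t [[0, (a†)^k], [a^k, 0]])`. -/
def idealS (Λ k : ℕ) (t : ℝ) : Op Λ :=
  NormedSpace.exp ((Complex.I * (t : ℂ)) •
    Matrix.fromBlocks 0 ((annihilation Λ)ᴴ ^ k) (annihilation Λ ^ k) 0)

/-! ### Circuits -/

/-- The two constituent gates that the algorithm may call. -/
inductive Side
  | left
  | right

/-- Elementary instructions: the qubit gates `X`, `S`, `S†`, `H`, and one use of a constituent gate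
for a given time, or of the inverse of that gate. -/
inductive Gate
  | pauliX
  | phase
  | phaseInv
  | hadamard
  | call (s : Side) (time : ℝ) (inverse : Bool)

/-- The instruction that undoes a given one. -/
def Gate.inv : Gate → Gate
  | .pauliX => .pauliX
  | .phase => .phaseInv
  | .phaseInv => .phase
  | .hadamard => .hadamard
  | .call s θ b => .call s θ (!b)

/-- Whether an instruction uses a constituent gate (or its inverse). -/
def Gate.isCall : Gate → Bool
  | .call _ _ _ => true
  | _ => false

/-- A circuit, written in the order of an operator product (the leftmost factor comes first). -/
abbrev Circuit := List Gate

/-- The inverse circuit. -/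
def Circuit.inverse (w : Circuit) : Circuit := (w.map Gate.inv).reverse

/-- The number of constituent gates used by a circuit. -/
def Circuit.numCalls (w : Circuit) : ℕ := w.countP Gate.isCall

/-- The operator of an instruction, for given implementations `Ul`, `Ur` of the two constituent
gates. -/
def Gate.eval {Λ : ℕ}
    (Ul Ur : ℝ → Matrix.unitaryGroup (Fin (Λ + 1) ⊕ Fin (Λ + 1)) ℂ) : Gate → Op Λ
  | .pauliX => Matrix.fromBlocks 0 1 1 0
  | .phase => Matrix.fromBlocks 1 0 0 (Complex.I • 1)
  | .phaseInv => Matrix.fromBlocks 1 0 0 (-Complex.I • 1)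
  | .hadamard => (((Real.sqrt 2)⁻¹ : ℝ) : ℂ) • Matrix.fromBlocks 1 1 1 (-1)
  | .call .left θ false => (Ul θ : Op Λ)
  | .call .left θ true => ((Ul θ)⁻¹ : Matrix.unitaryGroup _ ℂ)
  | .call .right θ false => (Ur θ : Op Λ)
  | .call .right θ true => ((Ur θ)⁻¹ : Matrix.unitaryGroup _ ℂ)

/-- The operator of a circuit. -/
def Circuit.eval {Λ : ℕ}
    (Ul Ur : ℝ → Matrix.unitaryGroup (Fin (Λ + 1) ⊕ Fin (Λ + 1)) ℂ) (w : Circuit) : Op Λ :=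
  (w.map (Gate.eval Ul Ur)).prod

/-- Use a constituent gate for a time of either sign; for a negative time this is the inverse of
the gate for the opposite time. -/
def callFor (s : Side) (θ : ℝ) : Circuit :=
  if 0 ≤ θ then [.call s θ false] else [.call s (-θ) true]

/-! ### Product formulas -/

/-- `r_p = 2^(1/(p+1)) / (4 (2 - 2^(1/(p+1))))`. -/
def bchR (p : ℕ) : ℝ :=
  (2 : ℝ) ^ (1 / ((p : ℝ) + 1)) / (4 * (2 - (2 : ℝ) ^ (1 / ((p : ℝ) + 1))))

/-- `β_p = (2 r_p)^(1/2)`. -/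
def bchBeta (p : ℕ) : ℝ := Real.sqrt (2 * bchR p)

/-- `γ_p = (1/4 + r_p)^(1/2)`. -/
def bchGamma (p : ℕ) : ℝ := Real.sqrt (1 / 4 + bchR p)

/-- The commutator product formula of order `p ≥ 1` for two families of circuits: the circuit
`bch p U V t` approximates `exp (t² [A, B])` when `U t`, `V t` approximate `exp (t A)`,
`exp (t B)`. (The value at `p = 0` is never used.) -/
def bch (U V : ℝ → Circuit) : ℕ → ℝ → Circuit
  | 0, _ => []
  | 1, t => U t ++ V t ++ U (-t) ++ V (-t)
  | p + 2, t =>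
    bch U V (p + 1) (bchGamma (p + 1) * t) ++ bch U V (p + 1) (-(bchGamma (p + 1) * t)) ++
    Circuit.inverse (bch U V (p + 1) (bchBeta (p + 1) * t)) ++
    Circuit.inverse (bch U V (p + 1) (-(bchBeta (p + 1) * t))) ++
    bch U V (p + 1) (bchGamma (p + 1) * t) ++ bch U V (p + 1) (-(bchGamma (p + 1) * t))

/-- `p_k = 1 / (4 - 4^(1/(2k-1)))`. -/
def suzukiP (k : ℕ) : ℝ := (4 - (4 : ℝ) ^ (1 / (2 * (k : ℝ) - 1)))⁻¹

/-- The Trotter-Suzuki formula `Trotter_{2k}`, `k ≥ 1`, for two families of circuits: the circuit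
`trotter L R k t` approximates `exp (t (A + B))` when `L t`, `R t` approximate `exp (t A)`,
`exp (t B)`. (The value at `k = 0` is never used.) -/
def trotter (L R : ℝ → Circuit) : ℕ → ℝ → Circuit
  | 0, _ => []
  | 1, t => L (t / 2) ++ R (t / 2) ++ R (t / 2) ++ L (t / 2)
  | k + 2, t =>
    trotter L R (k + 1) (suzukiP (k + 2) * t) ++ trotter L R (k + 1) (suzukiP (k + 2) * t) ++
    trotter L R (k + 1) ((1 - 4 * suzukiP (k + 2)) * t) ++
    trotter L R (k + 1) (suzukiP (k + 2) * t) ++ trotter L R (k + 1) (suzukiP (k + 2) * t)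

/-! ### The algorithm ADD -/

/-- The order `q = max (⌈(min(p_l, p_r) - 1) / 2⌉, 1)` of the product formulas. -/
def addOrder (pl pr : ℝ) : ℕ := max ⌈(min pl pr - 1) / 2⌉₊ 1

/-- Extend a family of circuits from nonnegative times to all times by inverse circuits. -/
def extendByInverse (W : ℝ → Circuit) (t : ℝ) : Circuit :=
  if 0 ≤ t then W t else Circuit.inverse (W (-t))

/-- `S H · BCH_q (X B_B X, B_A) (√(t/2)) · H S†`, where `B_A`, `B_B` are the left and the right
constituent gate. -/
def addLeft (q : ℕ) (t : ℝ) : Circuit :=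
  [.phase, .hadamard] ++
  bch (fun θ => [.pauliX] ++ callFor .right θ ++ [.pauliX]) (callFor .left) q (Real.sqrt (t / 2)) ++
  [.hadamard, .phaseInv]

/-- `H · BCH_q (S B_A S†, X B_B X) (√(t/2)) · H`. -/
def addRight (q : ℕ) (t : ℝ) : Circuit :=
  [.hadamard] ++
  bch (fun θ => [.phase] ++ callFor .left θ ++ [.phaseInv])
    (fun θ => [.pauliX] ++ callFor .right θ ++ [.pauliX]) q (Real.sqrt (t / 2)) ++
  [.hadamard]

/-- The circuit that ADD outputs for error orders `pl`, `pr` and time `t`. -/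
def addCircuit (pl pr t : ℝ) : Circuit :=
  [.pauliX] ++
  trotter (extendByInverse (addLeft (addOrder pl pr))) (extendByInverse (addRight (addOrder pl pr)))
    (addOrder pl pr) t ++
  [.pauliX]

end HybridAdder

end

noncomputable section

open NormedSpace Filter Topology Asymptotics

namespace HybridAdder

/-! ### Product formulas in a group -/

section GroupFormulas

variable {G G' : Type*} [Group G] [Group G']

/-! Write A and B for the skew-adjoint generators of the left gate and of the X-conjugated right
gate, and n for the sum of the two powers. Half of [B, A], conjugated by SH, is (a†^n - a^n)/2
tensored with Pauli Y. Half of [SAS†, B], conjugated by H, is i(a^n + a†^n)/2 tensored with Pauli X.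
Their sum, conjugated by X, is the generator of the target gate (`conjSkew_add_halfComm`). Only the
commutation of powers of one matrix is used, so the cutoff does no harm. It remains to exponentiate
commutators and a sum by product formulas.

For exact exponentials, the orders of the formulas come from a first-order calculus. Analytic
families that equal 1 at time 0 and agree up to order n have a leading coefficient of their
difference; it adds under products, changes sign under inverses and scales by r^n (`Approx`). The
numerical coefficients of the recursions make these leading terms cancel (`bchGroup_expUnit_isBigO`,
`trotterGroup_expUnit_isBigO`).

Uniformity in the cutoff costs nothing extra: the estimate is applied once, in the Banach algebra of
bounded families indexed by all pairs of contractions at all cutoffs, and then evaluated at an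
index. Rescaling time by c reduces operators of norm at most c to contractions. The ideal generators
have norm at most c, and the halved commutators have norm at most c².

Noise is harmless because errors of unitaries add under products and are unchanged by inversion
(`exists_close_bchGroup`, `exists_close_trotterGroup`). With m = min(p_l, p_r), the choice of q
gives m ≤ 2q + 1, so the commutator stage keeps error order m in cτ. Since τ² = t/2, this is order
m/2 in c²t, which the Trotter stage preserves. -/

/-- The commutator product formula for two families of elements of a group. -/
def bchGroup (U V : ℝ → G) : ℕ → ℝ → G
  | 0, _ => 1
  | 1, t => U t * V t * U (-t) * V (-t)
  | p + 2, t =>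
    bchGroup U V (p + 1) (bchGamma (p + 1) * t) * bchGroup U V (p + 1) (-(bchGamma (p + 1) * t)) *
    (bchGroup U V (p + 1) (bchBeta (p + 1) * t))⁻¹ *
    (bchGroup U V (p + 1) (-(bchBeta (p + 1) * t)))⁻¹ *
    bchGroup U V (p + 1) (bchGamma (p + 1) * t) * bchGroup U V (p + 1) (-(bchGamma (p + 1) * t))

/-- The Trotter-Suzuki formula for two families of elements of a group. -/
def trotterGroup (L R : ℝ → G) : ℕ → ℝ → G
  | 0, _ => 1
  | 1, t => L (t / 2) * R (t / 2) * R (t / 2) * L (t / 2)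
  | k + 2, t =>
    trotterGroup L R (k + 1) (suzukiP (k + 2) * t) *
    trotterGroup L R (k + 1) (suzukiP (k + 2) * t) *
    trotterGroup L R (k + 1) ((1 - 4 * suzukiP (k + 2)) * t) *
    trotterGroup L R (k + 1) (suzukiP (k + 2) * t) * trotterGroup L R (k + 1) (suzukiP (k + 2) * t)

theorem map_bchGroup (φ : G →* G') (U V : ℝ → G) (p : ℕ) (t : ℝ) :
    φ (bchGroup U V p t) = bchGroup (fun s => φ (U s)) (fun s => φ (V s)) p t := by
  induction p using Nat.twoStepInduction generalizing t with
  | zero => simp [bchGroup]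
  | one => simp [bchGroup]
  | more p _ ih => simp [bchGroup, ih]

theorem map_trotterGroup (φ : G →* G') (U V : ℝ → G) (p : ℕ) (t : ℝ) :
    φ (trotterGroup U V p t) = trotterGroup (fun s => φ (U s)) (fun s => φ (V s)) p t := by
  induction p using Nat.twoStepInduction generalizing t with
  | zero => simp [trotterGroup]
  | one => simp [trotterGroup]
  | more p _ ih => simp [trotterGroup, ih]

/-- The formula is a palindrome, so reversing time reverses the word. This symmetry is what removes
the even error orders. -/
theorem trotterGroup_neg {L R : ℝ → G} (hL : ∀ t, L (-t) = (L t)⁻¹) (hR : ∀ t, R (-t) = (R t)⁻¹)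
    (k : ℕ) (t : ℝ) : trotterGroup L R k (-t) = (trotterGroup L R k t)⁻¹ := by
  induction k using Nat.twoStepInduction generalizing t with
  | zero => simp [trotterGroup]
  | one => simp [trotterGroup, neg_div, hL, hR, mul_assoc]
  | more p _ ih => simp only [trotterGroup, mul_neg, ih, mul_inv_rev, mul_assoc]

end GroupFormulas

/-! ### The coefficients of the product formulas -/

theorem two_rpow_lt_two (p : ℕ) : (2 : ℝ) ^ (1 / (((p + 1 : ℕ) : ℝ) + 1)) < 2 := by
  have : (1 : ℝ) / (((p + 1 : ℕ) : ℝ) + 1) < 1 := by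
    rw [div_lt_one (by positivity)]; push_cast; linarith [(Nat.cast_nonneg p : (0 : ℝ) ≤ p)]
  simpa using Real.rpow_lt_rpow_of_exponent_lt (by norm_num : (1 : ℝ) < 2) this

theorem bchR_pos (p : ℕ) : 0 < bchR (p + 1) := by
  have := two_rpow_lt_two p
  rw [bchR]
  have h : 0 < 2 - (2 : ℝ) ^ (1 / (((p + 1 : ℕ) : ℝ) + 1)) := by linarith
  positivity

theorem bchBeta_pos (p : ℕ) : 0 < bchBeta (p + 1) := by
  have := bchR_pos p
  rw [bchBeta]; positivity

theorem bchGamma_pos (p : ℕ) : 0 < bchGamma (p + 1) := by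
  have := bchR_pos p
  rw [bchGamma]; positivity

/-- Consistency: the six factors of the recursion contribute these squared times, and the total must
again be exp(t²[A, B]). -/
theorem sq_bchGamma_sub_sq_bchBeta (p : ℕ) :
    4 * bchGamma (p + 1) ^ 2 - 2 * bchBeta (p + 1) ^ 2 = 1 := by
  have := bchR_pos p
  rw [bchGamma, bchBeta, Real.sq_sqrt (by positivity), Real.sq_sqrt (by positivity)]
  ring

/-- With s = 2^(1/(p+2)), the number r is chosen so that β² = s γ², and s^(p+2) = 2. This identity
cancels the leading error in the commutator recursion. -/
theorem two_mul_bchGamma_pow (p : ℕ) :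
    2 * bchGamma (p + 1) ^ (2 * (p + 2)) = bchBeta (p + 1) ^ (2 * (p + 2)) := by
  have h2 := two_rpow_lt_two p
  have hr := bchR_pos p
  rw [pow_mul, pow_mul, bchGamma, bchBeta, Real.sq_sqrt (by positivity),
    Real.sq_sqrt (by positivity)]
  have hs : ((2 : ℝ) ^ (1 / (((p + 1 : ℕ) : ℝ) + 1))) ^ (p + 2) = 2 := by
    rw [← Real.rpow_natCast, ← Real.rpow_mul (by norm_num)]
    push_cast
    rw [show (1 / ((p : ℝ) + 1 + 1) * (p + 2)) = 1 by field_simp; ring, Real.rpow_one]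
  set s := (2 : ℝ) ^ (1 / (((p + 1 : ℕ) : ℝ) + 1)) with hsdef
  have : 2 * bchR (p + 1) = s * (1 / 4 + bchR (p + 1)) := by
    rw [bchR, ← hsdef]
    have : 2 - s ≠ 0 := by linarith
    field_simp; ring
  rw [this, mul_pow, hs]

theorem four_rpow_lt_four (k : ℕ) : (4 : ℝ) ^ (1 / (2 * ((k + 2 : ℕ) : ℝ) - 1)) < 4 := by
  have hk : (0 : ℝ) ≤ k := Nat.cast_nonneg k
  have : (1 : ℝ) / (2 * ((k + 2 : ℕ) : ℝ) - 1) < 1 := by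
    push_cast
    rw [div_lt_one (by linarith)]; linarith
  simpa using Real.rpow_lt_rpow_of_exponent_lt (by norm_num : (1 : ℝ) < 4) this

theorem suzukiP_pos (k : ℕ) : 0 < suzukiP (k + 2) := by
  have := four_rpow_lt_four k
  rw [suzukiP, inv_pos]; linarith

theorem one_sub_four_mul_suzukiP (k : ℕ) :
    1 - 4 * suzukiP (k + 2) = -((4 : ℝ) ^ (1 / (2 * ((k + 2 : ℕ) : ℝ) - 1)) * suzukiP (k + 2)) := by
  have := four_rpow_lt_four k
  rw [suzukiP]
  have : 4 - (4 : ℝ) ^ (1 / (2 * ((k + 2 : ℕ) : ℝ) - 1)) ≠ 0 := by linarith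
  field_simp; ring

theorem one_sub_four_mul_suzukiP_ne_zero (k : ℕ) : 1 - 4 * suzukiP (k + 2) ≠ 0 := by
  have := suzukiP_pos k
  rw [one_sub_four_mul_suzukiP, neg_ne_zero]
  positivity

/-- The middle time is -4^(1/(2k+3)) times the outer one, and the exponent is odd, so the middle
error cancels the four outer ones. -/
theorem suzukiP_pow (k : ℕ) :
    4 * suzukiP (k + 2) ^ (2 * k + 3) + (1 - 4 * suzukiP (k + 2)) ^ (2 * k + 3) = 0 := by
  have hk : (0 : ℝ) ≤ k := Nat.cast_nonneg k
  rw [one_sub_four_mul_suzukiP, Odd.neg_pow ⟨k + 1, by ring⟩, mul_pow, ← Real.rpow_natCast (_ ^ _),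
    ← Real.rpow_mul (by norm_num)]
  push_cast
  rw [show (1 / (2 * ((k : ℝ) + 2) - 1) * (2 * k + 3)) = 1 by
    have : 2 * ((k : ℝ) + 2) - 1 ≠ 0 := by linarith
    field_simp; ring, Real.rpow_one]
  ring

/-! ### First order calculus in a Banach algebra -/

section Banach

variable {𝔸 : Type*} [NormedRing 𝔸] [NormedAlgebra ℝ 𝔸]

theorem isBigO_pow_of_le {m n : ℕ} (h : n ≤ m) :
    (fun t : ℝ => t ^ m) =O[𝓝 0] fun t : ℝ => t ^ n := by
  refine IsBigO.of_bound 1 ?_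
  filter_upwards [Metric.ball_mem_nhds (0 : ℝ) one_pos] with t ht
  rw [mem_ball_zero_iff] at ht
  rw [norm_pow, norm_pow, one_mul]
  exact pow_le_pow_of_le_one (norm_nonneg t) ht.le h

/-- Powers of t are divided out one at a time: the decay forces the current quotient to vanish at 0,
and its divided slope is again analytic. A big-O bound thereby yields an actual leading coefficient.
-/
theorem exists_eq_pow_smul_of_isBigO {f : ℝ → 𝔸} (hf : AnalyticAt ℝ f 0) (n : ℕ)
    (h : f =O[𝓝 0] fun t => t ^ n) :
    ∃ g : ℝ → 𝔸, AnalyticAt ℝ g 0 ∧ ∀ᶠ t in 𝓝 0, f t = t ^ n • g t := by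
  induction n with
  | zero => exact ⟨f, hf, by simp⟩
  | succ n ih =>
    obtain ⟨g, hg, hfg⟩ := ih (h.trans (isBigO_pow_of_le n.le_succ))
    have hg0 : g 0 = 0 := by
      have h1 : g =O[𝓝[≠] 0] fun t => t := by
        have h2 : (fun t => t ^ n • g t) =O[𝓝[≠] 0] fun t : ℝ => t ^ (n + 1) :=
          ((h.congr' hfg EventuallyEq.rfl)).mono nhdsWithin_le_nhds
        have h3 := (isBigO_refl (fun t : ℝ => (t ^ n)⁻¹) (𝓝[≠] 0)).smul h2
        refine h3.congr' ?_ ?_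
        · filter_upwards [self_mem_nhdsWithin] with t ht
          rw [smul_smul, inv_mul_cancel₀ (pow_ne_zero _ ht), one_smul]
        · filter_upwards [self_mem_nhdsWithin] with t ht
          rw [smul_eq_mul, pow_succ, inv_mul_cancel_left₀ (pow_ne_zero _ ht)]
      have h4 : Tendsto g (𝓝[≠] 0) (𝓝 0) :=
        h1.trans_tendsto (tendsto_id.mono_left nhdsWithin_le_nhds)
      exact tendsto_nhds_unique (hg.continuousAt.tendsto.mono_left nhdsWithin_le_nhds) h4
    obtain ⟨p, hp⟩ := hg
    refine ⟨dslope g 0, hp.has_fpower_series_dslope_fslope.analyticAt, ?_⟩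
    filter_upwards [hfg] with t ht
    have := sub_smul_dslope g 0 t
    rw [sub_zero, hg0, sub_zero] at this
    rw [ht, pow_succ, mul_smul, this]

theorem isBigO_sub_at_zero {f : ℝ → 𝔸} (hf : AnalyticAt ℝ f 0) :
    (fun t => f t - f 0) =O[𝓝 0] fun t : ℝ => t := by
  simpa using hf.differentiableAt.isBigO_sub

theorem exists_leading_coeff {f : ℝ → 𝔸} (hf : AnalyticAt ℝ f 0) (n : ℕ)
    (h : f =O[𝓝 0] fun t => t ^ n) :
    ∃ D : 𝔸, (fun t => f t - t ^ n • D) =O[𝓝 0] fun t : ℝ => t ^ (n + 1) := by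
  obtain ⟨g, hg, hfg⟩ := exists_eq_pow_smul_of_isBigO hf n h
  refine ⟨g 0, ?_⟩
  have h1 := (isBigO_refl (fun t : ℝ => t ^ n) (𝓝 0)).smul (isBigO_sub_at_zero hg)
  refine h1.congr' ?_ ?_
  · filter_upwards [hfg] with t ht
    rw [ht, smul_sub]
  · filter_upwards with t
    rw [smul_eq_mul, pow_succ]

theorem eq_zero_of_pow_smul_isBigO {n : ℕ} {D : 𝔸}
    (h : (fun t : ℝ => t ^ n • D) =O[𝓝 0] fun t : ℝ => t ^ (n + 1)) : D = 0 := by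
  have h1 : (fun _ : ℝ => D) =O[𝓝[≠] 0] fun t : ℝ => t := by
    have h3 := (isBigO_refl (fun t : ℝ => (t ^ n)⁻¹) (𝓝[≠] 0)).smul (h.mono nhdsWithin_le_nhds)
    refine h3.congr' ?_ ?_
    · filter_upwards [self_mem_nhdsWithin] with t ht
      rw [smul_smul, inv_mul_cancel₀ (pow_ne_zero _ ht), one_smul]
    · filter_upwards [self_mem_nhdsWithin] with t ht
      rw [smul_eq_mul, pow_succ, inv_mul_cancel_left₀ (pow_ne_zero _ ht)]
  exact tendsto_nhds_unique tendsto_const_nhds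
    (h1.trans_tendsto (tendsto_id.mono_left nhdsWithin_le_nhds))

/-- A family of units that is analytic at `0`, together with its inverse, and equal to `1` there. -/
structure AnalyticUnit (f : ℝ → 𝔸ˣ) : Prop where
  val : AnalyticAt ℝ (fun t => (f t : 𝔸)) 0
  inv : AnalyticAt ℝ (fun t => ((f t)⁻¹ : 𝔸ˣ).val) 0
  zero : f 0 = 1

theorem AnalyticUnit.mul {f g : ℝ → 𝔸ˣ} (hf : AnalyticUnit f) (hg : AnalyticUnit g) :
    AnalyticUnit (fun t => f t * g t) where
  val := by simpa using hf.val.fun_mul hg.val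
  inv := by simpa using hg.inv.fun_mul hf.inv
  zero := by simp [hf.zero, hg.zero]

theorem AnalyticUnit.inverse {f : ℝ → 𝔸ˣ} (hf : AnalyticUnit f) :
    AnalyticUnit (fun t => (f t)⁻¹) where
  val := hf.inv
  inv := by simpa using hf.val
  zero := by simp [hf.zero]

theorem AnalyticUnit.one : AnalyticUnit (fun _ => (1 : 𝔸ˣ)) where
  val := analyticAt_const
  inv := analyticAt_const
  zero := rfl

theorem analyticAt_scale {f : ℝ → 𝔸} (hf : AnalyticAt ℝ f 0) (r : ℝ) :
    AnalyticAt ℝ (fun t => f (r * t)) 0 := by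
  have h1 : AnalyticAt ℝ (fun t : ℝ => r * t) 0 := analyticAt_const.mul analyticAt_id
  exact AnalyticAt.fun_comp (by simpa using hf) h1

theorem AnalyticUnit.scale {f : ℝ → 𝔸ˣ} (hf : AnalyticUnit f) (r : ℝ) :
    AnalyticUnit (fun t => f (r * t)) where
  val := analyticAt_scale hf.val r
  inv := analyticAt_scale hf.inv r
  zero := by simp [hf.zero]

theorem AnalyticUnit.isBigO_one {f : ℝ → 𝔸ˣ} (hf : AnalyticUnit f) :
    (fun t => (f t : 𝔸)) =O[𝓝 0] fun _ => (1 : ℝ) :=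
  hf.val.continuousAt.tendsto.isBigO_one ℝ

theorem AnalyticUnit.isBigO_sub_one {f : ℝ → 𝔸ˣ} (hf : AnalyticUnit f) :
    (fun t => (f t : 𝔸) - 1) =O[𝓝 0] fun t : ℝ => t := by
  simpa [hf.zero] using isBigO_sub_at_zero hf.val

/-- The families `f` and `g` agree up to `t ^ n • D` and terms of order `n + 1`. -/
def Approx (n : ℕ) (f g : ℝ → 𝔸ˣ) (D : 𝔸) : Prop :=
  (fun t => (f t : 𝔸) - (g t : 𝔸) - t ^ n • D) =O[𝓝 0] fun t : ℝ => t ^ (n + 1)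

theorem Approx.isBigO_sub {n : ℕ} {f g : ℝ → 𝔸ˣ} (h : Approx n f g 0) :
    (fun t => (f t : 𝔸) - (g t : 𝔸)) =O[𝓝 0] fun t : ℝ => t ^ (n + 1) := by
  simpa [Approx] using h

theorem exists_approx {n : ℕ} {f g : ℝ → 𝔸ˣ} (hf : AnalyticUnit f) (hg : AnalyticUnit g)
    (h : (fun t => (f t : 𝔸) - (g t : 𝔸)) =O[𝓝 0] fun t : ℝ => t ^ n) :
    ∃ D, Approx n f g D :=
  exists_leading_coeff (hf.val.sub hg.val) n h

/-- From ff' - gg' = (f - g)f' + g(f' - g'): replacing f' and g by their value 1 at time 0 changes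
the leading terms only at order n + 1. -/
theorem Approx.mul {n : ℕ} {f g f' g' : ℝ → 𝔸ˣ} {D D' : 𝔸} (h : Approx n f g D)
    (h' : Approx n f' g' D') (hg : AnalyticUnit g)
    (hf' : AnalyticUnit f') :
    Approx n (fun t => f t * f' t) (fun t => g t * g' t) (D + D') := by
  have hn := isBigO_refl (fun t : ℝ => t ^ n) (𝓝 0)
  have h1 := IsBigO.mul h hf'.isBigO_one
  have h2 := hg.isBigO_one.mul h'
  have h3 := hn.smul (((isBigO_refl (fun _ : ℝ => D) (𝓝 0)).trans
    (isBigO_const_const D one_ne_zero (𝓝 (0 : ℝ)) : _ =O[_] fun _ => (1 : ℝ))).mul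
    hf'.isBigO_sub_one)
  have h4 := hn.smul (hg.isBigO_sub_one.mul ((isBigO_refl (fun _ : ℝ => D') (𝓝 0)).trans
    (isBigO_const_const D' one_ne_zero (𝓝 (0 : ℝ)) : _ =O[_] fun _ => (1 : ℝ))))
  simp only [mul_one, one_mul, smul_eq_mul, ← pow_succ] at h1 h2 h3 h4
  refine (((h1.add h2).add h3).add h4).congr_left fun t => ?_
  simp only [Units.val_mul, sub_mul, mul_sub, smul_mul_assoc, mul_smul_comm, smul_sub, smul_add,
    mul_one, one_mul]
  abel

/-- From f⁻¹ - g⁻¹ = -f⁻¹(f - g)g⁻¹, where the outer factors are 1 at time 0. -/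
theorem Approx.inverse {n : ℕ} {f g : ℝ → 𝔸ˣ} {D : 𝔸} (h : Approx n f g D)
    (hf : AnalyticUnit f) (hg : AnalyticUnit g) :
    Approx n (fun t => (f t)⁻¹) (fun t => (g t)⁻¹) (-D) := by
  have hn := isBigO_refl (fun t : ℝ => t ^ n) (𝓝 0)
  have hD : (fun _ : ℝ => D) =O[𝓝 0] fun _ => (1 : ℝ) := isBigO_const_const D one_ne_zero _
  have h1 := (hf.inverse.isBigO_one.mul h).mul hg.inverse.isBigO_one
  have h3 := hn.smul ((hf.inverse.isBigO_sub_one.mul hD).mul hg.inverse.isBigO_one)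
  have h4 := hn.smul (hD.mul hg.inverse.isBigO_sub_one)
  simp only [mul_one, one_mul, smul_eq_mul, ← pow_succ] at h1 h3 h4
  refine (((h1.add h3).add h4).neg_left).congr_left fun t => ?_
  simp only [sub_mul, mul_sub, smul_mul_assoc, mul_smul_comm, smul_sub, smul_neg,
    mul_one, one_mul, Units.inv_mul, mul_assoc, Units.mul_inv]
  abel

theorem Approx.scale {n : ℕ} {f g : ℝ → 𝔸ˣ} {D : 𝔸} (h : Approx n f g D) (r : ℝ) :
    Approx n (fun t => f (r * t)) (fun t => g (r * t)) (r ^ n • D) := by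
  have h0 : Tendsto (fun t : ℝ => r * t) (𝓝 0) (𝓝 0) := by
    simpa using (continuous_const_mul r).tendsto (0 : ℝ)
  have h1 := h.comp_tendsto h0
  have h2 : (fun t : ℝ => (r * t) ^ (n + 1)) =O[𝓝 0] fun t : ℝ => t ^ (n + 1) := by
    simp only [mul_pow]
    exact isBigO_const_mul_self _ _ _
  refine (h1.trans h2).congr_left fun t => ?_
  simp only [Function.comp_apply, mul_pow, smul_smul, mul_comm]

theorem Approx.unique {n : ℕ} {f g : ℝ → 𝔸ˣ} {D D' : 𝔸} (h : Approx n f g D)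
    (h' : Approx n f g D') : D = D' := by
  rw [← sub_eq_zero]
  refine eq_zero_of_pow_smul_isBigO (n := n) ((h'.sub h).congr_left fun t => ?_)
  rw [smul_sub]
  abel

theorem Approx.refl (n : ℕ) (f : ℝ → 𝔸ˣ) : Approx n f f 0 := by
  simp [Approx, isBigO_zero]

theorem AnalyticUnit.trotterGroup {L R : ℝ → 𝔸ˣ} (hL : AnalyticUnit L) (hR : AnalyticUnit R)
    (k : ℕ) : AnalyticUnit (trotterGroup L R k) := by
  induction k using Nat.twoStepInduction with
  | zero => exact AnalyticUnit.one
  | one =>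
    have h1 := hL.scale (1 / 2)
    have h2 := hR.scale (1 / 2)
    simpa [HybridAdder.trotterGroup, div_eq_inv_mul] using ((h1.mul h2).mul h2).mul h1
  | more k _ ih =>
    have h1 := ih.scale (suzukiP (k + 2))
    exact (((h1.mul h1).mul (ih.scale _)).mul h1).mul h1

theorem AnalyticUnit.bchGroup {U V : ℝ → 𝔸ˣ} (hU : AnalyticUnit U) (hV : AnalyticUnit V)
    (p : ℕ) : AnalyticUnit (bchGroup U V p) := by
  induction p using Nat.twoStepInduction with
  | zero => exact AnalyticUnit.one
  | one => simpa [HybridAdder.bchGroup] using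
      ((hU.mul hV).mul (hU.scale (-1))).mul (hV.scale (-1))
  | more p _ ih =>
    have h1 := ih.scale (bchGamma (p + 1))
    have h2 := ih.scale (-bchGamma (p + 1))
    have h3 := (ih.scale (bchBeta (p + 1))).inverse
    have h4 := (ih.scale (-bchBeta (p + 1))).inverse
    simp only [neg_mul] at h2 h4
    exact ((((h1.mul h2).mul h3).mul h4).mul h1).mul h2

/-- A time-symmetric formula of odd order is in fact of the next even order. -/
theorem isBigO_sub_of_symmetric {n : ℕ} {f g : ℝ → 𝔸ˣ} (hf : AnalyticUnit f) (hg : AnalyticUnit g)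
    (hfs : ∀ t, f (-t) = (f t)⁻¹) (hgs : ∀ t, g (-t) = (g t)⁻¹) (hn : Even n)
    (h : (fun t => (f t : 𝔸) - (g t : 𝔸)) =O[𝓝 0] fun t : ℝ => t ^ n) :
    (fun t => (f t : 𝔸) - (g t : 𝔸)) =O[𝓝 0] fun t : ℝ => t ^ (n + 1) := by
  obtain ⟨D, hD⟩ := exists_approx hf hg h
  -- Both f(t)f(-t) and g(t)g(-t) are identically 1, while the product rule gives their difference
  -- the leading coefficient D + (-1)^n D = 2D.
  have h1 := hD.mul (hD.scale (-1)) hg (hf.scale (-1))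
  simp only [neg_one_mul, hfs, hgs, mul_inv_cancel, hn.neg_one_pow, one_smul] at h1
  have h2 := h1.unique (Approx.refl n _)
  have h3 : D = 0 := by
    rw [← two_smul ℝ] at h2
    simpa using h2
  exact (h3 ▸ hD).isBigO_sub

end Banach

/-! ### Product formulas for exponentials in a Banach algebra -/

section Exponentials

variable {𝔸 : Type*} [NormedRing 𝔸] [NormedAlgebra ℝ 𝔸] [CompleteSpace 𝔸]

theorem exp_mul_exp_neg (x : 𝔸) : exp x * exp (-x) = 1 := by
  let _ := NormedAlgebra.restrictScalars ℚ ℝ 𝔸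
  rw [← exp_add_of_commute (Commute.refl x).neg_right, add_neg_cancel, exp_zero]

/-- The exponential as a unit. -/
def expUnit (x : 𝔸) : 𝔸ˣ where
  val := exp x
  inv := exp (-x)
  val_inv := exp_mul_exp_neg x
  inv_val := by simpa using exp_mul_exp_neg (-x)

@[simp] theorem val_expUnit (x : 𝔸) : (expUnit x : 𝔸) = exp x := rfl

theorem expUnit_neg (x : 𝔸) : expUnit (-x) = (expUnit x)⁻¹ := by
  ext; rfl

theorem expUnit_zero : expUnit (0 : 𝔸) = 1 := by
  ext; simp

theorem expUnit_smul_add (r s : ℝ) (x : 𝔸) :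
    expUnit ((r + s) • x) = expUnit (r • x) * expUnit (s • x) := by
  let _ := NormedAlgebra.restrictScalars ℚ ℝ 𝔸
  ext
  simp only [Units.val_mul, val_expUnit, add_smul]
  exact exp_add_of_commute (((Commute.refl x).smul_left r).smul_right s)

theorem analyticAt_exp_smul (f : ℝ → ℝ) (hf : AnalyticAt ℝ f 0) (x : 𝔸) :
    AnalyticAt ℝ (fun t => exp (f t • x)) 0 :=
  AnalyticAt.fun_comp (exp_analytic (𝕂 := ℝ) _) (hf.smul analyticAt_const)

theorem analyticUnit_expUnit {f : ℝ → ℝ} (hf : AnalyticAt ℝ f 0) (h0 : f 0 = 0) (x : 𝔸) :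
    AnalyticUnit (fun t => expUnit (f t • x)) where
  val := analyticAt_exp_smul f hf x
  inv := by
    simp only [← expUnit_neg, ← neg_smul]
    exact analyticAt_exp_smul _ hf.neg x
  zero := by simp [h0, expUnit_zero]

theorem analyticUnit_exp (x : 𝔸) : AnalyticUnit (fun t : ℝ => expUnit (t • x)) :=
  analyticUnit_expUnit analyticAt_id rfl x

theorem analyticUnit_exp_sq (x : 𝔸) : AnalyticUnit (fun t : ℝ => expUnit ((t ^ 2) • x)) :=
  analyticUnit_expUnit (f := fun t => t ^ 2) (analyticAt_id.pow 2) (by simp) x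

theorem exp_sub_one_sub_isBigO (x : 𝔸) :
    (fun t : ℝ => exp (t • x) - 1 - t • x) =O[𝓝 0] fun t : ℝ => t ^ 2 := by
  have h1 : (fun t : ℝ => exp (t • x) - 1) =O[𝓝 0] fun t : ℝ => t ^ 1 := by
    simpa using (analyticUnit_exp x).isBigO_sub_one
  have ha : AnalyticAt ℝ (fun t : ℝ => exp (t • x) - 1) 0 :=
    (analyticUnit_exp x).val.sub analyticAt_const
  obtain ⟨D, hD⟩ := exists_leading_coeff ha 1 h1
  have hd : HasDerivAt (fun t : ℝ => exp (t • x)) x 0 := by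
    simpa using hasDerivAt_exp_smul_const (𝕂 := ℝ) x (0 : ℝ)
  have h2 : (fun t : ℝ => exp (t • x) - 1 - t • x) =o[𝓝 0] fun t : ℝ => t := by
    simpa using hd.isLittleO
  have h3 : (fun t : ℝ => t ^ 2) =o[𝓝 0] fun t : ℝ => t := by
    simpa using isLittleO_pow_pow (𝕜 := ℝ) (show 1 < 2 by norm_num)
  have h4 : (fun t : ℝ => t • (x - D)) =o[𝓝 0] fun t : ℝ => t := by
    refine ((hD.trans_isLittleO h3).sub h2).congr_left fun t => ?_
    simp only [pow_one, smul_sub]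
    abel
  -- Analyticity supplied a second-order remainder with an unknown linear term D; the derivative at
  -- 0 identifies it as x.
  have h5 : x - D = 0 := by
    have h7 : HasDerivAt (fun t : ℝ => t • (x - D)) 0 0 := by
      rw [hasDerivAt_iff_isLittleO]; simpa using h4
    have h8 : HasDerivAt (fun t : ℝ => t • (x - D)) (x - D) 0 := by
      simpa using (hasDerivAt_id (0 : ℝ)).smul_const (x - D)
    exact h8.unique h7
  obtain rfl := sub_eq_zero.1 h5
  simpa using hD

theorem approx_exp_one (x : 𝔸) : Approx 1 (fun t => expUnit (t • x)) (fun _ => 1) x := by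
  simpa [Approx] using exp_sub_one_sub_isBigO x

theorem trotterGroup_expUnit_neg (A B : 𝔸) (k : ℕ) (t : ℝ) :
    trotterGroup (fun s : ℝ => expUnit (s • A)) (fun s : ℝ => expUnit (s • B)) k (-t) =
      (trotterGroup (fun s : ℝ => expUnit (s • A)) (fun s : ℝ => expUnit (s • B)) k t)⁻¹ :=
  trotterGroup_neg (by simp [expUnit_neg]) (by simp [expUnit_neg]) k t

/-- The Trotter-Suzuki formula of index `k` has order `2k`. -/
theorem trotterGroup_expUnit_isBigO (A B : 𝔸) (k : ℕ) :
    (fun t : ℝ => (trotterGroup (fun s : ℝ => expUnit (s • A)) (fun s : ℝ => expUnit (s • B))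
      (k + 1) t).val - (expUnit (t • (A + B))).val) =O[𝓝 0] fun t : ℝ => t ^ (2 * (k + 1) + 1) := by
  have hT := AnalyticUnit.trotterGroup (analyticUnit_exp A) (analyticUnit_exp B)
  have hE := analyticUnit_exp (A + B)
  have hEs : ∀ t : ℝ, expUnit (-t • (A + B)) = (expUnit (t • (A + B)))⁻¹ := fun t => by
    rw [neg_smul, expUnit_neg]
  induction k with
  | zero =>
    -- Matching linear terms is enough: it gives O(t²), and symmetry raises this to O(t³).
    refine isBigO_sub_of_symmetric (hT 1) hE (trotterGroup_expUnit_neg A B 1) hEs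
      even_two ?_
    have hA := (approx_exp_one A).scale (1 / 2)
    have hB := (approx_exp_one B).scale (1 / 2)
    have h1 := AnalyticUnit.one (𝔸 := 𝔸)
    have hA' := (analyticUnit_exp A).scale (1 / 2)
    have hB' := (analyticUnit_exp B).scale (1 / 2)
    have h2 := ((hA.mul hB h1 hB').mul hB (h1.mul h1) hB').mul hA ((h1.mul h1).mul h1) hA'
    have h3 := h2.sub (approx_exp_one (A + B))
    refine h3.congr_left fun t => ?_
    simp only [trotterGroup, div_eq_inv_mul, mul_one, pow_one]
    have : (2⁻¹ : ℝ) • A + (2⁻¹ : ℝ) • B + (2⁻¹ : ℝ) • B + (2⁻¹ : ℝ) • A = A + B := by module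
    rw [this]
    abel
  | succ k ih =>
    -- Cancelling the coefficient of t^(2k+3) gives O(t^(2k+4)); this exponent is even, so symmetry
    -- supplies the remaining power.
    have h0 := isBigO_sub_of_symmetric (n := 2 * k + 4) (hT (k + 2)) hE
      (trotterGroup_expUnit_neg A B _) hEs ⟨k + 2, by ring⟩ ?_
    · exact h0
    obtain ⟨D, hD⟩ := exists_approx (n := 2 * k + 3) (hT (k + 1)) hE ih
    have hP := hD.scale (suzukiP (k + 2))
    have hQ := hD.scale (1 - 4 * suzukiP (k + 2))
    have tP := (hT (k + 1)).scale (suzukiP (k + 2))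
    have tQ := (hT (k + 1)).scale (1 - 4 * suzukiP (k + 2))
    have eP := hE.scale (suzukiP (k + 2))
    have eQ := hE.scale (1 - 4 * suzukiP (k + 2))
    have h2 := (((hP.mul hP eP tP).mul hQ (eP.mul eP) tQ).mul hP ((eP.mul eP).mul eQ) tP).mul hP
      (((eP.mul eP).mul eQ).mul eP) tP
    have h3 : suzukiP (k + 2) ^ (2 * k + 3) • D + suzukiP (k + 2) ^ (2 * k + 3) • D +
        (1 - 4 * suzukiP (k + 2)) ^ (2 * k + 3) • D + suzukiP (k + 2) ^ (2 * k + 3) • D +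
        suzukiP (k + 2) ^ (2 * k + 3) • D = 0 := by
      have := congrArg (· • D) (suzukiP_pow k)
      simp only [zero_smul, add_smul, mul_smul] at this
      rw [← this]; module
    rw [h3] at h2
    refine h2.isBigO_sub.congr_left fun t => ?_
    simp only [← expUnit_smul_add]
    rw [trotterGroup]
    congr 4
    ring

theorem bchGroup_one_expUnit_isBigO (A B : 𝔸) :
    (fun t : ℝ => (bchGroup (fun s : ℝ => expUnit (s • A)) (fun s : ℝ => expUnit (s • B)) 1 t).val -
      (expUnit (t ^ 2 • (A * B - B * A))).val) =O[𝓝 0] fun t : ℝ => t ^ 3 := by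
  set C := A * B - B * A
  have hA := analyticUnit_exp A
  have hB := analyticUnit_exp B
  have hW := hA.inverse.mul hB.inverse
  have hCc : (fun _ : ℝ => C) =O[𝓝 0] fun _ => (1 : ℝ) := isBigO_const_const C one_ne_zero _
  have hAc : (fun _ : ℝ => A) =O[𝓝 0] fun _ => (1 : ℝ) := isBigO_const_const A one_ne_zero _
  have ht := isBigO_refl (fun t : ℝ => t) (𝓝 0)
  have ht2 := isBigO_refl (fun t : ℝ => t ^ 2) (𝓝 0)
  have hExp : (fun t : ℝ => exp (t ^ 2 • C) - 1 - t ^ 2 • C) =O[𝓝 0] fun t : ℝ => t ^ 3 := by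
    have h0 : Tendsto (fun t : ℝ => t ^ 2) (𝓝 0) (𝓝 0) := by
      simpa using (continuous_pow 2).tendsto (0 : ℝ)
    have h1 := (exp_sub_one_sub_isBigO C).comp_tendsto h0
    refine h1.trans (((isBigO_pow_of_le (show 3 ≤ 4 by norm_num))).congr_left fun t => ?_)
    simp only [Function.comp_apply]; ring
  -- Write X = exp a, Y = exp b with a = tA, b = tB, and W = X⁻¹Y⁻¹. Since YXW = 1, the formula is 1
  -- + (XY - YX)W. The four estimates decompose (XY - YX) - (ab - ba) through the commutators of X -
  -- 1 - a with Y - 1 and of a with Y - 1 - b.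
  have e1 := ((exp_sub_one_sub_isBigO A).mul hB.isBigO_sub_one).congr_right
    (fun t => show t ^ 2 * t = t ^ 3 by ring)
  have e2 := (hB.isBigO_sub_one.mul (exp_sub_one_sub_isBigO A)).congr_right
    (fun t => show t * t ^ 2 = t ^ 3 by ring)
  have e3 := ((ht.smul hAc).mul (exp_sub_one_sub_isBigO B)).congr_right
    (fun t => show t • (1 : ℝ) * t ^ 2 = t ^ 3 by rw [smul_eq_mul]; ring)
  have e4 := ((exp_sub_one_sub_isBigO B).mul (ht.smul hAc)).congr_right
    (fun t => show t ^ 2 * t • (1 : ℝ) = t ^ 3 by rw [smul_eq_mul]; ring)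
  have f1 := ((((e1.sub e2).add e3).sub e4).mul hW.isBigO_one).congr_right
    (fun t => mul_one (t ^ 3))
  have f2 := (ht2.smul (hCc.mul hW.isBigO_sub_one)).congr_right
    (fun t => show t ^ 2 • (1 * t) = t ^ 3 by rw [smul_eq_mul]; ring)
  refine ((f1.add f2).sub hExp).congr_left fun t => ?_
  have hK : (bchGroup (fun s : ℝ => expUnit (s • A)) (fun s : ℝ => expUnit (s • B)) 1 t).val =
      exp (t • A) * exp (t • B) * (((expUnit (t • A))⁻¹ * (expUnit (t • B))⁻¹ : 𝔸ˣ) : 𝔸) := by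
    simp [bchGroup, expUnit_neg, mul_assoc]
  have hI : exp (t • B) * exp (t • A) *
      (((expUnit (t • A))⁻¹ * (expUnit (t • B))⁻¹ : 𝔸ˣ) : 𝔸) = 1 := by
    rw [← val_expUnit, ← val_expUnit, ← Units.val_mul, ← Units.val_mul]
    simp [mul_assoc]
  rw [hK, val_expUnit]
  simp only [val_expUnit]
  generalize (((expUnit (t • A))⁻¹ * (expUnit (t • B))⁻¹ : 𝔸ˣ) : 𝔸) = W at *
  generalize exp (t • A) = X at *
  generalize exp (t • B) = Y at *
  generalize exp (t ^ 2 • C) = Z at *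
  have hC : t ^ 2 • C = (t • A) * (t • B) - (t • B) * (t • A) := by
    simp only [C, smul_mul_smul_comm, ← smul_sub, sq]
  rw [← smul_mul_assoc, hC]
  generalize t • A = a at *
  generalize t • B = b at *
  calc _ = X * Y * W - Y * X * W + 1 - Z := by noncomm_ring
    _ = _ := by rw [hI, sub_add_cancel]

/-- The commutator formula of index `p` approximates `exp (t² [A, B])` to order `2p`. -/
theorem bchGroup_expUnit_isBigO (A B : 𝔸) (p : ℕ) :
    (fun t : ℝ => (bchGroup (fun s : ℝ => expUnit (s • A)) (fun s : ℝ => expUnit (s • B))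
      (p + 1) t).val - (expUnit (t ^ 2 • (A * B - B * A))).val) =O[𝓝 0]
      fun t : ℝ => t ^ (2 * (p + 1) + 1) := by
  have hF := AnalyticUnit.bchGroup (analyticUnit_exp A) (analyticUnit_exp B)
  have hG := analyticUnit_exp_sq (A * B - B * A)
  induction p with
  | zero => exact bchGroup_one_expUnit_isBigO A B
  | succ p ih =>
    set C := A * B - B * A
    set F := bchGroup (fun s : ℝ => expUnit (s • A)) (fun s : ℝ => expUnit (s • B)) (p + 1)
    obtain ⟨D, hD⟩ := exists_approx (n := 2 * p + 3) (hF (p + 1)) hG ih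
    have fn := (hF (p + 1)).scale (-1)
    have gn := hG.scale (-1)
    -- Pairing F(t) with F(-t) cancels the odd leading term, so the pair has an error of order 2p +
    -- 4, with coefficient E.
    have h1 := hD.mul (hD.scale (-1)) hG fn
    have hP := (hF (p + 1)).mul fn
    have hQ := hG.mul gn
    rw [Odd.neg_one_pow ⟨p + 1, by ring⟩, neg_one_smul, add_neg_cancel] at h1
    obtain ⟨E, hE⟩ := exists_approx hP hQ h1.isBigO_sub
    have h2 := hE.scale (bchGamma (p + 1))
    -- The sign of β matters: (F(-βt)F(βt))⁻¹ = F(βt)⁻¹F(-βt)⁻¹ is the order of factors in the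
    -- recursion.
    have h3 := (hE.scale (-bchBeta (p + 1))).inverse (hP.scale _) (hQ.scale _)
    have h4 := (h2.mul h3 (hQ.scale _) (hP.scale _).inverse).mul h2
      ((hQ.scale _).mul (hQ.scale _).inverse) (hP.scale _)
    have h5 : bchGamma (p + 1) ^ (2 * p + 3 + 1) • E +
        -((-bchBeta (p + 1)) ^ (2 * p + 3 + 1) • E) + bchGamma (p + 1) ^ (2 * p + 3 + 1) • E
        = 0 := by
      rw [Even.neg_pow ⟨p + 2, by ring⟩, show 2 * p + 3 + 1 = 2 * (p + 2) by ring,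
        ← two_mul_bchGamma_pow]
      module
    rw [h5] at h4
    refine h4.isBigO_sub.congr_left fun t => ?_
    congr 1
    · simp only [bchGroup, mul_inv_rev, neg_mul, one_mul, neg_neg, mul_assoc]
    · simp only [← expUnit_smul_add, ← expUnit_neg, ← neg_smul]
      congr 3
      linear_combination t ^ 2 * sq_bchGamma_sub_sq_bchBeta p

end Exponentials

/-! ### Uniform error bounds for the exact product formulas -/

section Uniform

/-- Pairs of operators of norm at most one, for all photon cutoffs. -/
def ContractionPair : Type := Σ Λ : ℕ, {x : Op Λ × Op Λ // ‖x.1‖ ≤ 1 ∧ ‖x.2‖ ≤ 1}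

/-- The Banach algebra of bounded families of operators, indexed by all pairs of contractions. -/
abbrev Universal : Type := lp (fun i : ContractionPair => Op i.1) ⊤

/-- The family of the first components of all pairs. -/
def universalFst : Universal :=
  ⟨fun i => i.2.1.1, memℓp_infty ⟨1, by rintro _ ⟨i, rfl⟩; exact i.2.2.1⟩⟩

/-- The family of the second components of all pairs. -/
def universalSnd : Universal :=
  ⟨fun i => i.2.1.2, memℓp_infty ⟨1, by rintro _ ⟨i, rfl⟩; exact i.2.2.2⟩⟩

/-- Evaluation of a bounded family at an index. -/
def evalAt (i : ContractionPair) : Universal →+* Op i.1 where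
  toFun x := x i
  map_one' := by simp [lp.infty_coeFn_one]
  map_mul' x y := by simp [lp.infty_coeFn_mul]
  map_zero' := by simp
  map_add' x y := by simp

theorem norm_evalAt_le (i : ContractionPair) (x : Universal) : ‖evalAt i x‖ ≤ ‖x‖ :=
  lp.norm_apply_le_norm ENNReal.top_ne_zero x i

theorem evalAt_smul (i : ContractionPair) (r : ℝ) (x : Universal) :
    evalAt i (r • x) = r • evalAt i x := rfl

theorem evalAt_exp (i : ContractionPair) (x : Universal) : evalAt i (exp x) = exp (evalAt i x) := by
  let _ := NormedAlgebra.restrictScalars ℚ ℝ Universal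
  let _ := NormedAlgebra.restrictScalars ℚ ℝ (Op i.1)
  exact map_exp _ (AddMonoidHomClass.continuous_of_bound (evalAt i) 1
    fun x => by simpa using norm_evalAt_le i x) x

theorem map_evalAt_expUnit (i : ContractionPair) (r : ℝ) (x : Universal) :
    Units.map (evalAt i : Universal →* Op i.1) (expUnit (r • x)) = expUnit (r • evalAt i x) := by
  ext1
  simp [evalAt_exp, evalAt_smul]

theorem exists_bound_of_isBigO {E : Type*} [NormedAddCommGroup E] {f : ℝ → E} {n : ℕ}
    (h : f =O[𝓝 0] fun t : ℝ => t ^ n) :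
    ∃ K ε : ℝ, 0 < ε ∧ ∀ t, |t| ≤ ε → ‖f t‖ ≤ K * |t| ^ n := by
  obtain ⟨K, hK⟩ := h.bound
  obtain ⟨ε, hε, hb⟩ := Metric.nhds_basis_closedBall.eventually_iff.1 hK
  refine ⟨K, ε, hε, fun t ht => ?_⟩
  simpa using hb (mem_closedBall_zero_iff.2 ht)

/-- Evaluation at an index is a norm-nonincreasing ring homomorphism that commutes with exponentials
and product formulas. One estimate for the universal pair thus bounds every pair with the same
constants. -/
theorem exists_bound_bchGroup_contractions (p : ℕ) :
    ∃ K ε : ℝ, 0 < ε ∧ ∀ (Λ : ℕ) (A B : Op Λ), ‖A‖ ≤ 1 → ‖B‖ ≤ 1 → ∀ t : ℝ, |t| ≤ ε →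
      ‖(bchGroup (fun s : ℝ => expUnit (s • A)) (fun s : ℝ => expUnit (s • B)) (p + 1) t).val -
        exp (t ^ 2 • (A * B - B * A))‖ ≤ K * |t| ^ (2 * (p + 1) + 1) := by
  obtain ⟨K, ε, hε, h⟩ := exists_bound_of_isBigO
    (bchGroup_expUnit_isBigO universalFst universalSnd p)
  refine ⟨K, ε, hε, fun Λ A B hA hB t ht => ?_⟩
  let i : ContractionPair := ⟨Λ, (A, B), hA, hB⟩
  refine le_trans (le_of_eq ?_) ((norm_evalAt_le i _).trans (h t ht))
  have h1 := congrArg Units.val (map_bchGroup (Units.map (evalAt i : Universal →* Op i.1))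
    (fun s : ℝ => expUnit (s • universalFst)) (fun s : ℝ => expUnit (s • universalSnd)) (p + 1) t)
  simp only [map_evalAt_expUnit] at h1
  rw [map_sub, val_expUnit, evalAt_exp, evalAt_smul, map_sub, map_mul, map_mul]
  exact congrArg (fun x : Op Λ => ‖x - exp (t ^ 2 • (A * B - B * A))‖) h1.symm

theorem exists_bound_trotterGroup_contractions (k : ℕ) :
    ∃ K ε : ℝ, 0 < ε ∧ ∀ (Λ : ℕ) (A B : Op Λ), ‖A‖ ≤ 1 → ‖B‖ ≤ 1 → ∀ t : ℝ, |t| ≤ ε →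
      ‖(trotterGroup (fun s : ℝ => expUnit (s • A)) (fun s : ℝ => expUnit (s • B)) (k + 1) t).val -
        exp (t • (A + B))‖ ≤ K * |t| ^ (2 * (k + 1) + 1) := by
  obtain ⟨K, ε, hε, h⟩ := exists_bound_of_isBigO
    (trotterGroup_expUnit_isBigO universalFst universalSnd k)
  refine ⟨K, ε, hε, fun Λ A B hA hB t ht => ?_⟩
  let i : ContractionPair := ⟨Λ, (A, B), hA, hB⟩
  refine le_trans (le_of_eq ?_) ((norm_evalAt_le i _).trans (h t ht))
  have h1 := congrArg Units.val (map_trotterGroup (Units.map (evalAt i : Universal →* Op i.1))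
    (fun s : ℝ => expUnit (s • universalFst)) (fun s : ℝ => expUnit (s • universalSnd)) (k + 1) t)
  simp only [map_evalAt_expUnit] at h1
  rw [map_sub, val_expUnit, evalAt_exp, evalAt_smul, map_add]
  exact congrArg (fun x : Op Λ => ‖x - exp (t • (A + B))‖) h1.symm

theorem bchGroup_comp_mul {G : Type*} [Group G] (U V : ℝ → G) (r : ℝ) (p : ℕ) (t : ℝ) :
    bchGroup (fun s => U (r * s)) (fun s => V (r * s)) p t = bchGroup U V p (r * t) := by
  induction p using Nat.twoStepInduction generalizing t with
  | zero => rfl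
  | one => simp [bchGroup]
  | more p _ ih => simp only [bchGroup, ih, mul_neg, mul_left_comm r]

theorem trotterGroup_comp_mul {G : Type*} [Group G] (U V : ℝ → G) (r : ℝ) (p : ℕ) (t : ℝ) :
    trotterGroup (fun s => U (r * s)) (fun s => V (r * s)) p t = trotterGroup U V p (r * t) := by
  induction p using Nat.twoStepInduction generalizing t with
  | zero => rfl
  | one => simp [trotterGroup, mul_div_assoc]
  | more p _ ih => simp only [trotterGroup, ih, mul_left_comm r]

theorem norm_inv_smul_le_one {Λ : ℕ} {c : ℝ} (hc : 0 < c) {A : Op Λ} (hA : ‖A‖ ≤ c) :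
    ‖c⁻¹ • A‖ ≤ 1 := by
  rw [norm_smul, norm_inv, Real.norm_of_nonneg hc.le, inv_mul_le_iff₀ hc, mul_one]
  exact hA

theorem mul_smul_inv_smul {Λ : ℕ} {c : ℝ} (hc : 0 < c) (s : ℝ) (A : Op Λ) :
    (c * s) • c⁻¹ • A = s • A := by
  rw [smul_smul]
  congr 1
  field_simp

/-- Rescaling: the operators A/c, B/c at time ct are contractions with the same exponentials. -/
theorem exists_bound_bchGroup_expUnit (p : ℕ) :
    ∃ K ε : ℝ, 0 < ε ∧ ∀ (Λ : ℕ) (c : ℝ) (A B : Op Λ), 0 < c → ‖A‖ ≤ c → ‖B‖ ≤ c →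
      ∀ t : ℝ, c * |t| ≤ ε →
      ‖(bchGroup (fun s : ℝ => expUnit (s • A)) (fun s : ℝ => expUnit (s • B)) (p + 1) t).val -
        exp (t ^ 2 • (A * B - B * A))‖ ≤ K * (c * |t|) ^ (2 * (p + 1) + 1) := by
  obtain ⟨K, ε, hε, h⟩ := exists_bound_bchGroup_contractions p
  refine ⟨K, ε, hε, fun Λ c A B hc hA hB t ht => ?_⟩
  have habs : |c * t| = c * |t| := by rw [abs_mul, abs_of_pos hc]
  have h1 := h Λ (c⁻¹ • A) (c⁻¹ • B) (norm_inv_smul_le_one hc hA) (norm_inv_smul_le_one hc hB)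
    (c * t) (habs ▸ ht)
  rw [habs, ← bchGroup_comp_mul] at h1
  have h2 : (c * t) ^ 2 • ((c⁻¹ • A) * (c⁻¹ • B) - (c⁻¹ • B) * (c⁻¹ • A)) =
      t ^ 2 • (A * B - B * A) := by
    rw [smul_mul_smul_comm, smul_mul_smul_comm, ← smul_sub, smul_smul]
    congr 1
    field_simp
  simpa only [mul_smul_inv_smul hc, h2] using h1

theorem exists_bound_trotterGroup_expUnit (k : ℕ) :
    ∃ K ε : ℝ, 0 < ε ∧ ∀ (Λ : ℕ) (c : ℝ) (A B : Op Λ), 0 < c → ‖A‖ ≤ c → ‖B‖ ≤ c →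
      ∀ t : ℝ, c * |t| ≤ ε →
      ‖(trotterGroup (fun s : ℝ => expUnit (s • A)) (fun s : ℝ => expUnit (s • B)) (k + 1) t).val -
        exp (t • (A + B))‖ ≤ K * (c * |t|) ^ (2 * (k + 1) + 1) := by
  obtain ⟨K, ε, hε, h⟩ := exists_bound_trotterGroup_contractions k
  refine ⟨K, ε, hε, fun Λ c A B hc hA hB t ht => ?_⟩
  have habs : |c * t| = c * |t| := by rw [abs_mul, abs_of_pos hc]
  have h1 := h Λ (c⁻¹ • A) (c⁻¹ • B) (norm_inv_smul_le_one hc hA) (norm_inv_smul_le_one hc hB)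
    (c * t) (habs ▸ ht)
  rw [habs, ← trotterGroup_comp_mul] at h1
  simpa only [← smul_add, mul_smul_inv_smul hc] using h1

end Uniform

/-! ### Unitary families that are close to each other -/

section Perturbation

/-- The unitary operators on the qubit and the mode. -/
abbrev UOp (Λ : ℕ) := Matrix.unitaryGroup (Fin (Λ + 1) ⊕ Fin (Λ + 1)) ℂ

/-- The unitary families `f` and `g` agree to order `m` at all small nonzero times. -/
def Close {Λ : ℕ} (m c K δ : ℝ) (f g : ℝ → UOp Λ) : Prop :=
  ∀ t : ℝ, t ≠ 0 → c * |t| ≤ δ → ‖(f t : Op Λ) - (g t : Op Λ)‖ ≤ K * (c * |t|) ^ m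

variable {Λ : ℕ} {m c K K' δ δ' : ℝ} {f g f' g' : ℝ → UOp Λ}

theorem norm_mul_sub_mul_le (a b a' b' : UOp Λ) :
    ‖((a * b : UOp Λ) : Op Λ) - ((a' * b' : UOp Λ) : Op Λ)‖ ≤
      ‖(a : Op Λ) - (a' : Op Λ)‖ + ‖(b : Op Λ) - (b' : Op Λ)‖ := by
  have : ((a * b : UOp Λ) : Op Λ) - ((a' * b' : UOp Λ) : Op Λ) =
      ((a : Op Λ) - a') * b + a' * ((b : Op Λ) - b') := by
    simp only [Submonoid.coe_mul]; noncomm_ring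
  rw [this]
  refine (norm_add_le _ _).trans (le_of_eq ?_)
  rw [CStarRing.norm_mul_coe_unitary, CStarRing.norm_coe_unitary_mul]

theorem norm_inv_sub_inv (a b : UOp Λ) :
    ‖((a⁻¹ : UOp Λ) : Op Λ) - ((b⁻¹ : UOp Λ) : Op Λ)‖ = ‖(a : Op Λ) - (b : Op Λ)‖ := by
  have h (x : UOp Λ) : ((x⁻¹ : UOp Λ) : Op Λ) = star (x : Op Λ) := rfl
  rw [h, h, ← star_sub, norm_star]

theorem Close.mul (h : Close m c K δ f g) (h' : Close m c K' δ' f' g') :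
    Close m c (K + K') (min δ δ') (fun t => f t * f' t) (fun t => g t * g' t) := fun t ht htc => by
  rw [add_mul]
  exact (norm_mul_sub_mul_le _ _ _ _).trans
    (add_le_add (h t ht (htc.trans (min_le_left _ _))) (h' t ht (htc.trans (min_le_right _ _))))

theorem Close.inv (h : Close m c K δ f g) :
    Close m c K δ (fun t => (f t)⁻¹) (fun t => (g t)⁻¹) := fun t ht htc => by
  rw [norm_inv_sub_inv]
  exact h t ht htc

/-- The factor must be nonzero because closeness says nothing at time 0, where nothing is assumed
about the noisy gates. -/
theorem Close.scale (hc : 0 ≤ c) (h : Close m c K δ f g) {r : ℝ} (hr : r ≠ 0) :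
    Close m c (K * |r| ^ m) (δ / |r|) (fun t => f (r * t)) (fun t => g (r * t)) :=
  fun t ht htc => by
  have h1 : c * |r * t| = |r| * (c * |t|) := by rw [abs_mul]; ring
  have h2 := h (r * t) (mul_ne_zero hr ht) (by
    rw [h1]; rwa [le_div_iff₀' (abs_pos.2 hr)] at htc)
  rwa [h1, Real.mul_rpow (abs_nonneg r) (by positivity), ← mul_assoc] at h2

theorem Close.const (δ : ℝ) (a : UOp Λ) : Close m c 0 δ (fun _ => a) (fun _ => a) := by
  simp [Close]

/-- The formula is a fixed word in the two families at fixed multiples of t, so the new constants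
are chosen before the cutoff, c and the families. -/
theorem exists_close_bchGroup (m K δ : ℝ) (hδ : 0 < δ) (p : ℕ) :
    ∃ K' δ' : ℝ, 0 < δ' ∧ ∀ (Λ : ℕ) (c : ℝ), 0 ≤ c → ∀ U U' V V' : ℝ → UOp Λ,
      Close m c K δ U U' → Close m c K δ V V' →
      Close m c K' δ' (bchGroup U V p) (bchGroup U' V' p) := by
  induction p using Nat.twoStepInduction with
  | zero => exact ⟨0, 1, one_pos, fun Λ c _ U U' V V' _ _ => Close.const 1 1⟩
  | one =>
    -- The unsimplified constants are the ones that `Close.mul` and `Close.scale` produce for the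
    -- four factors.
    refine ⟨K + K + K * |-1| ^ m + K * |-1| ^ m, min (min (min δ δ) (δ / |-1|)) (δ / |-1|), by simpa using hδ,
      fun Λ c hc U U' V V' hU hV => ?_⟩
    have := ((hU.mul hV).mul (hU.scale hc (neg_ne_zero.2 one_ne_zero))).mul
      (hV.scale hc (neg_ne_zero.2 one_ne_zero))
    simp only [neg_one_mul] at this
    exact this
  | more p _ ih =>
    obtain ⟨K', δ', hδ', h⟩ := ih
    have hg := bchGamma_pos p
    have hb := bchBeta_pos p
    refine ⟨K' * |bchGamma (p + 1)| ^ m + K' * |-bchGamma (p + 1)| ^ m + K' * |bchBeta (p + 1)| ^ m +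
      K' * |-bchBeta (p + 1)| ^ m + K' * |bchGamma (p + 1)| ^ m + K' * |-bchGamma (p + 1)| ^ m,
      min (min (min (min (min (δ' / |bchGamma (p + 1)|) (δ' / |-bchGamma (p + 1)|))
      (δ' / |bchBeta (p + 1)|)) (δ' / |-bchBeta (p + 1)|)) (δ' / |bchGamma (p + 1)|))
      (δ' / |-bchGamma (p + 1)|), by simp only [abs_neg]; positivity,
      fun Λ c hc U U' V V' hU hV => ?_⟩
    have h0 := h Λ c hc U U' V V' hU hV
    have h1 := h0.scale hc hg.ne'
    have h2 := h0.scale hc (neg_ne_zero.2 hg.ne')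
    have h3 := (h0.scale hc hb.ne').inv
    have h4 := (h0.scale hc (neg_ne_zero.2 hb.ne')).inv
    simp only [neg_mul] at h2 h4
    exact ((((h1.mul h2).mul h3).mul h4).mul h1).mul h2

theorem exists_close_trotterGroup (m K δ : ℝ) (hδ : 0 < δ) (k : ℕ) :
    ∃ K' δ' : ℝ, 0 < δ' ∧ ∀ (Λ : ℕ) (c : ℝ), 0 ≤ c → ∀ L L' R R' : ℝ → UOp Λ,
      Close m c K δ L L' → Close m c K δ R R' →
      Close m c K' δ' (trotterGroup L R k) (trotterGroup L' R' k) := by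
  induction k using Nat.twoStepInduction with
  | zero => exact ⟨0, 1, one_pos, fun Λ c _ U U' V V' _ _ => Close.const 1 1⟩
  | one =>
    refine ⟨K * |2⁻¹| ^ m + K * |2⁻¹| ^ m + K * |2⁻¹| ^ m + K * |2⁻¹| ^ m,
      min (min (min (δ / |2⁻¹|) (δ / |2⁻¹|)) (δ / |2⁻¹|)) (δ / |2⁻¹|), by positivity,
      fun Λ c hc L L' R R' hL hR => ?_⟩
    have h1 := hL.scale hc (inv_ne_zero two_ne_zero)
    have h2 := hR.scale hc (inv_ne_zero two_ne_zero)
    simp only [← div_eq_inv_mul] at h1 h2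
    exact ((h1.mul h2).mul h2).mul h1
  | more k _ ih =>
    obtain ⟨K', δ', hδ', h⟩ := ih
    have hp := (suzukiP_pos k).ne'
    have hp' := one_sub_four_mul_suzukiP_ne_zero k
    refine ⟨K' * |suzukiP (k + 2)| ^ m + K' * |suzukiP (k + 2)| ^ m +
      K' * |1 - 4 * suzukiP (k + 2)| ^ m + K' * |suzukiP (k + 2)| ^ m + K' * |suzukiP (k + 2)| ^ m,
      min (min (min (min (δ' / |suzukiP (k + 2)|) (δ' / |suzukiP (k + 2)|))
      (δ' / |1 - 4 * suzukiP (k + 2)|)) (δ' / |suzukiP (k + 2)|)) (δ' / |suzukiP (k + 2)|),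
      by positivity, fun Λ c hc L L' R R' hL hR => ?_⟩
    have h0 := h Λ c hc L L' R R' hL hR
    have h1 := h0.scale hc hp
    exact (((h1.mul h1).mul (h0.scale hc hp')).mul h1).mul h1

end Perturbation

/-! ### Numbers of calls -/

section Calls

theorem numCalls_append (v w : Circuit) :
    Circuit.numCalls (v ++ w) = Circuit.numCalls v + Circuit.numCalls w :=
  List.countP_append

theorem numCalls_inverse (w : Circuit) : Circuit.numCalls (Circuit.inverse w) = w.numCalls := by
  have : Gate.isCall ∘ Gate.inv = Gate.isCall := by
    funext g; cases g <;> rfl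
  simp [Circuit.numCalls, Circuit.inverse, List.countP_map, this]

theorem numCalls_callFor (s : Side) (θ : ℝ) : Circuit.numCalls (callFor s θ) = 1 := by
  unfold callFor; split_ifs <;> rfl

theorem numCalls_bch {U V : ℝ → Circuit} (hU : ∀ t, (U t).numCalls = 1)
    (hV : ∀ t, (V t).numCalls = 1) (p : ℕ) (t : ℝ) :
    (bch U V (p + 1) t).numCalls = 4 * 6 ^ p := by
  induction p generalizing t with
  | zero => simp [bch, numCalls_append, hU, hV]
  | succ p ih => simp only [bch, numCalls_append, numCalls_inverse, ih]; ring

theorem numCalls_trotter {L R : ℝ → Circuit} {n : ℕ} (hL : ∀ t, (L t).numCalls = n)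
    (hR : ∀ t, (R t).numCalls = n) (k : ℕ) (t : ℝ) :
    (trotter L R (k + 1) t).numCalls = 4 * n * 5 ^ k := by
  induction k generalizing t with
  | zero => simp only [trotter, numCalls_append, hL, hR]; ring
  | succ k ih => simp only [trotter, numCalls_append, ih]; ring

theorem numCalls_extendByInverse {W : ℝ → Circuit} {n : ℕ} (hW : ∀ t, (W t).numCalls = n) (t : ℝ) :
    (extendByInverse W t).numCalls = n := by
  unfold extendByInverse; split_ifs <;> simp [numCalls_inverse, hW]

theorem addOrder_pos (pl pr : ℝ) : 0 < addOrder pl pr := lt_max_of_lt_right one_pos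

/-- The base formulas have four factors each, giving 16; a commutator step multiplies the count by 6
and a Suzuki step by 5. -/
theorem numCalls_addCircuit (pl pr t : ℝ) :
    (addCircuit pl pr t).numCalls = 16 * 30 ^ (addOrder pl pr - 1) := by
  obtain ⟨p, hp⟩ := Nat.exists_eq_succ_of_ne_zero (addOrder_pos pl pr).ne'
  have h0 (g : Gate) (hg : g.isCall = false) : Circuit.numCalls [g] = 0 := by
    simp [Circuit.numCalls, hg]
  have hX := h0 .pauliX rfl
  have hS := h0 .phase rfl
  have hS' := h0 .phaseInv rfl
  have hx (θ : ℝ) : Circuit.numCalls ([.pauliX] ++ callFor .right θ ++ [.pauliX]) = 1 := by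
    simp only [numCalls_append, numCalls_callFor, hX]
  have hs (θ : ℝ) : Circuit.numCalls ([.phase] ++ callFor .left θ ++ [.phaseInv]) = 1 := by
    simp only [numCalls_append, numCalls_callFor, hS, hS']
  have hl (s : ℝ) : (addLeft (p + 1) s).numCalls = 4 * 6 ^ p := by
    simp only [addLeft, numCalls_append, numCalls_bch hx (numCalls_callFor _)]
    simp [Circuit.numCalls, Gate.isCall]
  have hr (s : ℝ) : (addRight (p + 1) s).numCalls = 4 * 6 ^ p := by
    simp only [addRight, numCalls_append, numCalls_bch hs hx]
    simp [Circuit.numCalls, Gate.isCall]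
  simp only [addCircuit, hp, Nat.succ_eq_add_one, numCalls_append, hX,
    numCalls_trotter (numCalls_extendByInverse hl) (numCalls_extendByInverse hr),
    Nat.add_sub_cancel]
  rw [show 30 = 6 * 5 by norm_num, mul_pow]
  ring

end Calls

/-! ### Circuits as unitaries -/

section Eval

variable {Λ : ℕ}

theorem inv_sqrt_two_mul_self :
    (((Real.sqrt 2)⁻¹ : ℝ) : ℂ) * (((Real.sqrt 2)⁻¹ : ℝ) : ℂ) = 1 / 2 := by
  rw [← Complex.ofReal_mul, ← mul_inv, Real.mul_self_sqrt (by norm_num)]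
  norm_num

theorem fromBlocks_pauliX_conj (a b c d : Matrix (Fin (Λ + 1)) (Fin (Λ + 1)) ℂ) :
    (Matrix.fromBlocks 0 1 1 0 : Op Λ) * Matrix.fromBlocks a b c d * Matrix.fromBlocks 0 1 1 0 =
      Matrix.fromBlocks d c b a := by
  simp [Matrix.fromBlocks_multiply]

theorem fromBlocks_phase_conj (a b c d : Matrix (Fin (Λ + 1)) (Fin (Λ + 1)) ℂ) :
    (Matrix.fromBlocks 1 0 0 (Complex.I • 1) : Op Λ) * Matrix.fromBlocks a b c d *
      Matrix.fromBlocks 1 0 0 (-Complex.I • 1) =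
      Matrix.fromBlocks a (-Complex.I • b) (Complex.I • c) d := by
  simp [Matrix.fromBlocks_multiply, smul_smul]

theorem fromBlocks_hadamard_conj (a b c d : Matrix (Fin (Λ + 1)) (Fin (Λ + 1)) ℂ) :
    ((((Real.sqrt 2)⁻¹ : ℝ) : ℂ) • Matrix.fromBlocks 1 1 1 (-1) : Op Λ) *
      Matrix.fromBlocks a b c d *
      ((((Real.sqrt 2)⁻¹ : ℝ) : ℂ) • Matrix.fromBlocks 1 1 1 (-1) : Op Λ) =
      (1 / 2 : ℂ) • Matrix.fromBlocks (a + b + c + d) (a - b + c - d) (a + b - c - d)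
        (a - b - c + d) := by
  rw [smul_mul_assoc, smul_mul_assoc, mul_smul_comm, smul_smul, inv_sqrt_two_mul_self]
  simp only [Matrix.fromBlocks_multiply, one_mul, mul_one, neg_mul, mul_neg]
  congr 2 <;> abel

theorem fromBlocks_one_one : (Matrix.fromBlocks 1 0 0 1 : Op Λ) = 1 := Matrix.fromBlocks_one

theorem hadamard_mul_self :
    ((((Real.sqrt 2)⁻¹ : ℝ) : ℂ) • Matrix.fromBlocks 1 1 1 (-1) : Op Λ) *
      ((((Real.sqrt 2)⁻¹ : ℝ) : ℂ) • Matrix.fromBlocks 1 1 1 (-1) : Op Λ) = 1 := by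
  have h := fromBlocks_hadamard_conj (Λ := Λ) 1 0 0 1
  rw [fromBlocks_one_one, mul_one] at h
  rw [h]
  simp [Matrix.fromBlocks_smul, ← two_smul ℂ, smul_smul, Matrix.fromBlocks_one]

/-- The unitary of an instruction. -/
def Gate.evalU (Ul Ur : ℝ → UOp Λ) : Gate → UOp Λ
  | .pauliX => ⟨Matrix.fromBlocks 0 1 1 0, by
      rw [Matrix.mem_unitaryGroup_iff, Matrix.star_eq_conjTranspose]
      simp [Matrix.fromBlocks_conjTranspose, Matrix.fromBlocks_multiply]⟩
  | .phase => ⟨Matrix.fromBlocks 1 0 0 (Complex.I • 1), by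
      rw [Matrix.mem_unitaryGroup_iff, Matrix.star_eq_conjTranspose]
      simp [Matrix.fromBlocks_conjTranspose, Matrix.fromBlocks_multiply, smul_smul]⟩
  | .phaseInv => ⟨Matrix.fromBlocks 1 0 0 (-Complex.I • 1), by
      rw [Matrix.mem_unitaryGroup_iff, Matrix.star_eq_conjTranspose]
      simp [Matrix.fromBlocks_conjTranspose, Matrix.fromBlocks_multiply, smul_smul]⟩
  | .hadamard => ⟨(((Real.sqrt 2)⁻¹ : ℝ) : ℂ) • Matrix.fromBlocks 1 1 1 (-1), by
      have h : star ((((Real.sqrt 2)⁻¹ : ℝ) : ℂ) • Matrix.fromBlocks 1 1 1 (-1) : Op Λ) =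
          (((Real.sqrt 2)⁻¹ : ℝ) : ℂ) • Matrix.fromBlocks 1 1 1 (-1) := by
        rw [star_smul, Matrix.star_eq_conjTranspose, Matrix.fromBlocks_conjTranspose]
        simp
      rw [Matrix.mem_unitaryGroup_iff, h, hadamard_mul_self]⟩
  | .call .left θ false => Ul θ
  | .call .left θ true => (Ul θ)⁻¹
  | .call .right θ false => Ur θ
  | .call .right θ true => (Ur θ)⁻¹

theorem Gate.coe_evalU (Ul Ur : ℝ → UOp Λ) (g : Gate) :
    (g.evalU Ul Ur : Op Λ) = g.eval Ul Ur := by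
  rcases g with _ | _ | _ | _ | ⟨_ | _, θ, _ | _⟩ <;> rfl

theorem Gate.evalU_inv (Ul Ur : ℝ → UOp Λ) (g : Gate) :
    g.inv.evalU Ul Ur = (g.evalU Ul Ur)⁻¹ := by
  rcases g with _ | _ | _ | _ | ⟨_ | _, θ, _ | _⟩
  · rw [eq_inv_iff_mul_eq_one]
    ext1
    simp [Gate.inv, Gate.evalU, Matrix.fromBlocks_multiply]
  · rw [eq_inv_iff_mul_eq_one]
    ext1
    simp [Gate.inv, Gate.evalU, Matrix.fromBlocks_multiply, smul_smul]
  · rw [eq_inv_iff_mul_eq_one]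
    ext1
    simp [Gate.inv, Gate.evalU, Matrix.fromBlocks_multiply, smul_smul]
  · rw [eq_inv_iff_mul_eq_one]
    exact Subtype.ext hadamard_mul_self
  · rfl
  · exact (inv_inv _).symm
  · rfl
  · exact (inv_inv _).symm

/-- The unitary of a circuit. -/
def Circuit.evalU (Ul Ur : ℝ → UOp Λ) (w : Circuit) : UOp Λ := (w.map (Gate.evalU Ul Ur)).prod

variable (Ul Ur : ℝ → UOp Λ)

theorem Circuit.coe_evalU (w : Circuit) : (w.evalU Ul Ur : Op Λ) = w.eval Ul Ur := by
  induction w with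
  | nil => rfl
  | cons g w ih =>
    rw [Circuit.evalU, Circuit.eval, List.map_cons, List.map_cons, List.prod_cons, List.prod_cons,
      Submonoid.coe_mul, Gate.coe_evalU]
    exact congrArg _ ih

theorem Circuit.evalU_append (v w : Circuit) :
    Circuit.evalU Ul Ur (v ++ w) = v.evalU Ul Ur * w.evalU Ul Ur := by
  simp [Circuit.evalU]

theorem Circuit.evalU_singleton (g : Gate) : Circuit.evalU Ul Ur [g] = g.evalU Ul Ur := by
  simp [Circuit.evalU]

theorem Circuit.evalU_inverse (w : Circuit) :
    (Circuit.inverse w).evalU Ul Ur = (w.evalU Ul Ur)⁻¹ := by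
  rw [Circuit.evalU, Circuit.evalU, List.prod_inv_reverse, Circuit.inverse, List.map_reverse,
    List.map_map, List.map_map]
  congr 3
  funext g
  exact Gate.evalU_inv Ul Ur g

theorem evalU_bch (U V : ℝ → Circuit) (p : ℕ) (t : ℝ) :
    (bch U V p t).evalU Ul Ur =
      bchGroup (fun s => (U s).evalU Ul Ur) (fun s => (V s).evalU Ul Ur) p t := by
  induction p using Nat.twoStepInduction generalizing t with
  | zero => rfl
  | one => simp only [bch, bchGroup, Circuit.evalU_append]
  | more p _ ih => simp only [bch, bchGroup, Circuit.evalU_append, Circuit.evalU_inverse, ih]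

theorem evalU_trotter (L R : ℝ → Circuit) (k : ℕ) (t : ℝ) :
    (trotter L R k t).evalU Ul Ur =
      trotterGroup (fun s => (L s).evalU Ul Ur) (fun s => (R s).evalU Ul Ur) k t := by
  induction k using Nat.twoStepInduction generalizing t with
  | zero => rfl
  | one => simp only [trotter, trotterGroup, Circuit.evalU_append]
  | more p _ ih => simp only [trotter, trotterGroup, Circuit.evalU_append, ih]

theorem evalU_extendByInverse (W : ℝ → Circuit) (t : ℝ) :
    (extendByInverse W t).evalU Ul Ur =
      if 0 ≤ t then (W t).evalU Ul Ur else ((W (-t)).evalU Ul Ur)⁻¹ := by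
  unfold extendByInverse
  split_ifs
  · rfl
  · exact Circuit.evalU_inverse Ul Ur _

end Eval

/-! ### Exponentials of skew-adjoint operators -/

section Skew

variable {Λ : ℕ}

/-- The unitary group generated by a skew-adjoint operator. -/
def expUnitary (A : skewAdjoint (Op Λ)) (t : ℝ) : UOp Λ :=
  ⟨exp (t • (A : Op Λ)), by
    let _ := NormedAlgebra.restrictScalars ℚ ℝ (Op Λ)
    exact exp_mem_unitary_of_mem_skewAdjoint (skewAdjoint.smul_mem t A.2)⟩

theorem coe_expUnitary (A : skewAdjoint (Op Λ)) (t : ℝ) :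
    (expUnitary A t : Op Λ) = exp (t • (A : Op Λ)) := rfl

theorem toUnits_expUnitary (A : skewAdjoint (Op Λ)) (t : ℝ) :
    Unitary.toUnits (expUnitary A t) = expUnit (t • (A : Op Λ)) := by
  ext1; rfl

theorem expUnitary_neg (A : skewAdjoint (Op Λ)) (t : ℝ) :
    expUnitary A (-t) = (expUnitary A t)⁻¹ := by
  apply Unitary.toUnits_injective
  rw [map_inv, toUnits_expUnitary, toUnits_expUnitary, neg_smul, expUnit_neg]

/-- The conjugate of a skew-adjoint operator by a unitary. -/
def conjSkew (w : UOp Λ) (A : skewAdjoint (Op Λ)) : skewAdjoint (Op Λ) :=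
  ⟨w * A * (w⁻¹ : UOp Λ), skewAdjoint.conjugate A.2 (w : Op Λ)⟩

theorem coe_conjSkew (w : UOp Λ) (A : skewAdjoint (Op Λ)) :
    (conjSkew w A : Op Λ) = w * A * (w⁻¹ : UOp Λ) := rfl

theorem norm_conjSkew (w : UOp Λ) (A : skewAdjoint (Op Λ)) :
    ‖(conjSkew w A : Op Λ)‖ = ‖(A : Op Λ)‖ := by
  rw [coe_conjSkew, CStarRing.norm_mul_coe_unitary, CStarRing.norm_coe_unitary_mul]

theorem expUnitary_conjSkew (w : UOp Λ) (A : skewAdjoint (Op Λ)) (t : ℝ) :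
    expUnitary (conjSkew w A) t = w * expUnitary A t * w⁻¹ := by
  let _ := NormedAlgebra.restrictScalars ℚ ℝ (Op Λ)
  refine Subtype.ext ?_
  have := exp_units_conj (Unitary.toUnits w) (t • (A : Op Λ))
  rw [mul_smul_comm, smul_mul_assoc] at this
  exact this

/-- The commutator of two skew-adjoint operators. -/
def commSkew (A B : skewAdjoint (Op Λ)) : skewAdjoint (Op Λ) :=
  ⟨A * B - B * A, by
    rw [skewAdjoint.mem_iff, star_sub, star_mul, star_mul, skewAdjoint.mem_iff.1 A.2,
      skewAdjoint.mem_iff.1 B.2]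
    noncomm_ring⟩

theorem coe_commSkew (A B : skewAdjoint (Op Λ)) : (commSkew A B : Op Λ) = A * B - B * A := rfl

/-- Half of the conjugate of a commutator. -/
def halfComm (w : UOp Λ) (A B : skewAdjoint (Op Λ)) : skewAdjoint (Op Λ) :=
  (1 / 2 : ℝ) • conjSkew w (commSkew A B)

/-- The half absorbs the factor 2 of the commutator bound, so the Trotter stage can run with the
scale c². -/
theorem norm_halfComm_le (w : UOp Λ) {A B : skewAdjoint (Op Λ)} {c : ℝ} (hA : ‖(A : Op Λ)‖ ≤ c)
    (hB : ‖(B : Op Λ)‖ ≤ c) : ‖(halfComm w A B : Op Λ)‖ ≤ c ^ 2 := by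
  have hc : 0 ≤ c := (norm_nonneg _).trans hA
  rw [halfComm, skewAdjoint.val_smul, norm_smul, norm_conjSkew, coe_commSkew]
  have h1 : ‖(A : Op Λ) * B‖ ≤ c * c := (norm_mul_le _ _).trans (by gcongr)
  have h2 : ‖(B : Op Λ) * A‖ ≤ c * c := (norm_mul_le _ _).trans (by gcongr)
  have h3 := norm_sub_le ((A : Op Λ) * B) (B * A)
  rw [Real.norm_of_nonneg (by norm_num)]
  linarith

theorem coe_bchGroup_expUnitary (A B : skewAdjoint (Op Λ)) (p : ℕ) (t : ℝ) :
    (bchGroup (expUnitary A) (expUnitary B) p t).val =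
      (bchGroup (fun s : ℝ => expUnit (s • (A : Op Λ))) (fun s : ℝ => expUnit (s • (B : Op Λ)))
        p t).val := by
  have := congrArg Units.val (map_bchGroup Unitary.toUnits (expUnitary A) (expUnitary B) p t)
  simp only [toUnits_expUnitary] at this
  exact this

theorem coe_trotterGroup_expUnitary (A B : skewAdjoint (Op Λ)) (p : ℕ) (t : ℝ) :
    (trotterGroup (expUnitary A) (expUnitary B) p t).val =
      (trotterGroup (fun s : ℝ => expUnit (s • (A : Op Λ))) (fun s : ℝ => expUnit (s • (B : Op Λ)))
        p t).val := by
  have := congrArg Units.val (map_trotterGroup Unitary.toUnits (expUnitary A) (expUnitary B) p t)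
  simp only [toUnits_expUnitary] at this
  exact this

theorem Close.conj {m c K δ : ℝ} {f g : ℝ → UOp Λ} (h : Close m c K δ f g) (w : UOp Λ) :
    Close m c K δ (fun t => w * f t * w⁻¹) (fun t => w * g t * w⁻¹) := by
  simpa using ((Close.const δ w).mul h).mul (Close.const δ w⁻¹)

theorem Close.conjSkew {m c K δ : ℝ} {f : ℝ → UOp Λ} {A : skewAdjoint (Op Λ)}
    (h : Close m c K δ f (expUnitary A)) (w : UOp Λ) :
    Close m c K δ (fun t => w * f t * w⁻¹) (expUnitary (conjSkew w A)) := by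
  have := h.conj w
  simpa only [← expUnitary_conjSkew] using this

end Skew

/-! ### Product formulas with noisy constituents -/

section Noisy

/-- Lowers the integer order of the exact formulas to the real order of the noise. This is why the
thresholds below are capped at 1; the absolute value is there because K has no known sign. -/
theorem mul_pow_le_abs_mul_rpow {K x m : ℝ} {n : ℕ} (hx : 0 < x) (hx1 : x ≤ 1) (hm : m ≤ n) :
    K * x ^ n ≤ |K| * x ^ m := by
  rw [← Real.rpow_natCast]
  have h1 := Real.rpow_le_rpow_of_exponent_ge hx hx1 hm
  have h2 : 0 ≤ x ^ (n : ℝ) := by positivity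
  have h3 := abs_nonneg K
  exact (mul_le_mul_of_nonneg_right (le_abs_self K) h2).trans (by gcongr)

theorem exists_bound_bchGroup (m K δ : ℝ) (hδ : 0 < δ) (p : ℕ)
    (hm : m ≤ ((2 * (p + 1) + 1 : ℕ) : ℝ)) :
    ∃ K' δ' : ℝ, 0 < δ' ∧ ∀ (Λ : ℕ) (c : ℝ), 0 < c → ∀ A B : skewAdjoint (Op Λ),
      ‖(A : Op Λ)‖ ≤ c → ‖(B : Op Λ)‖ ≤ c → ∀ U V : ℝ → UOp Λ,
      Close m c K δ U (expUnitary A) → Close m c K δ V (expUnitary B) →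
      ∀ t : ℝ, 0 < t → c * t ≤ δ' →
        ‖(bchGroup U V (p + 1) t).val - (expUnitary (commSkew A B) (t ^ 2)).val‖ ≤
          K' * (c * t) ^ m := by
  obtain ⟨K₁, δ₁, hδ₁, h₁⟩ := exists_close_bchGroup m K δ hδ (p + 1)
  obtain ⟨K₂, δ₂, hδ₂, h₂⟩ := exists_bound_bchGroup_expUnit p
  refine ⟨K₁ + |K₂|, min (min δ₁ δ₂) 1, by positivity,
    fun Λ c hc A B hA hB U V hU hV t ht htc => ?_⟩
  have hct : 0 < c * t := mul_pos hc ht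
  simp only [le_min_iff] at htc
  have e₁ := h₁ Λ c hc.le U _ V _ hU hV t ht.ne' (by rw [abs_of_pos ht]; exact htc.1.1)
  have e₂ := h₂ Λ c A B hc hA hB t (by rw [abs_of_pos ht]; exact htc.1.2)
  rw [abs_of_pos ht] at e₁ e₂
  rw [← coe_bchGroup_expUnitary] at e₂
  have e₃ := e₂.trans (mul_pow_le_abs_mul_rpow hct htc.2 hm)
  rw [add_mul]
  exact (norm_sub_le_norm_sub_add_norm_sub _ _ _).trans (add_le_add e₁ e₃)

theorem exists_bound_trotterGroup (m K δ : ℝ) (hδ : 0 < δ) (k : ℕ)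
    (hm : m ≤ ((2 * (k + 1) + 1 : ℕ) : ℝ)) :
    ∃ K' δ' : ℝ, 0 < δ' ∧ ∀ (Λ : ℕ) (c : ℝ), 0 < c → ∀ A B : skewAdjoint (Op Λ),
      ‖(A : Op Λ)‖ ≤ c → ‖(B : Op Λ)‖ ≤ c → ∀ L R : ℝ → UOp Λ,
      Close m c K δ L (expUnitary A) → Close m c K δ R (expUnitary B) →
      ∀ t : ℝ, 0 < t → c * t ≤ δ' →
        ‖(trotterGroup L R (k + 1) t).val - (expUnitary (A + B) t).val‖ ≤ K' * (c * t) ^ m := by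
  obtain ⟨K₁, δ₁, hδ₁, h₁⟩ := exists_close_trotterGroup m K δ hδ (k + 1)
  obtain ⟨K₂, δ₂, hδ₂, h₂⟩ := exists_bound_trotterGroup_expUnit k
  refine ⟨K₁ + |K₂|, min (min δ₁ δ₂) 1, by positivity,
    fun Λ c hc A B hA hB U V hU hV t ht htc => ?_⟩
  have hct : 0 < c * t := mul_pos hc ht
  simp only [le_min_iff] at htc
  have e₁ := h₁ Λ c hc.le U _ V _ hU hV t ht.ne' (by rw [abs_of_pos ht]; exact htc.1.1)
  have e₂ := h₂ Λ c A B hc hA hB t (by rw [abs_of_pos ht]; exact htc.1.2)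
  rw [abs_of_pos ht] at e₁ e₂
  rw [← coe_trotterGroup_expUnitary] at e₂
  have e₃ := e₂.trans (mul_pow_le_abs_mul_rpow hct htc.2 hm)
  rw [add_mul]
  exact (norm_sub_le_norm_sub_add_norm_sub _ _ _).trans (add_le_add e₁ e₃)

/-- Inversion preserves the distance of unitaries, so bounds at positive times carry over to the
extension by inverses. -/
theorem close_extend {Λ : ℕ} {m c K δ : ℝ} {W : ℝ → UOp Λ} {A : skewAdjoint (Op Λ)}
    (h : ∀ t : ℝ, 0 < t → c * t ≤ δ →
      ‖(W t : Op Λ) - (expUnitary A t : Op Λ)‖ ≤ K * (c * t) ^ m) :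
    Close m c K δ (fun t => if 0 ≤ t then W t else (W (-t))⁻¹) (expUnitary A) := by
  intro t ht htc
  rcases ht.lt_or_gt with h0 | h0
  · have h1 := h (-t) (neg_pos.2 h0) (by rwa [abs_of_neg h0] at htc)
    beta_reduce
    rwa [if_neg h0.not_ge, ← neg_neg t, expUnitary_neg, norm_inv_sub_inv, abs_neg,
      abs_of_pos (neg_pos.2 h0), neg_neg t]
  · have h1 := h t h0 (by rwa [abs_of_pos h0] at htc)
    beta_reduce
    rwa [if_pos h0.le, abs_of_pos h0]

theorem norm_conj_sub_conj_le {Λ : ℕ} (w a b : UOp Λ) :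
    ‖((w * a * w⁻¹ : UOp Λ) : Op Λ) - ((w * b * w⁻¹ : UOp Λ) : Op Λ)‖ ≤
      ‖(a : Op Λ) - (b : Op Λ)‖ := by
  have h1 := norm_mul_sub_mul_le (w * a) w⁻¹ (w * b) w⁻¹
  have h2 := norm_mul_sub_mul_le w a w b
  simp only [sub_self, norm_zero, add_zero, zero_add] at h1 h2
  exact h1.trans h2

/-- At time √(t/2) the commutator is exponentiated for time t/2, hence the half in the generator.
The square root also turns order m at scale c into order m/2 at scale c². -/
theorem exists_close_halfComm (m K δ : ℝ) (hδ : 0 < δ) (hm0 : 0 ≤ m) (p : ℕ)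
    (hm : m ≤ ((2 * (p + 1) + 1 : ℕ) : ℝ)) :
    ∃ K' δ' : ℝ, 0 < δ' ∧ ∀ (Λ : ℕ) (c : ℝ), 0 < c → ∀ A B : skewAdjoint (Op Λ),
      ‖(A : Op Λ)‖ ≤ c → ‖(B : Op Λ)‖ ≤ c → ∀ (U V W : ℝ → UOp Λ) (w : UOp Λ),
      Close m c K δ U (expUnitary A) → Close m c K δ V (expUnitary B) →
      (∀ t, W t = w * bchGroup U V (p + 1) (Real.sqrt (t / 2)) * w⁻¹) →
      Close (m / 2) (c ^ 2) K' δ' (fun t => if 0 ≤ t then W t else (W (-t))⁻¹)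
        (expUnitary (halfComm w A B)) := by
  obtain ⟨K₁, δ₁, hδ₁, h₁⟩ := exists_bound_bchGroup m K δ hδ p hm
  refine ⟨|K₁|, δ₁ ^ 2, by positivity, fun Λ c hc A B hA hB U V W w hU hV hW => close_extend ?_⟩
  intro t ht htc
  have hs : 0 < Real.sqrt (t / 2) := Real.sqrt_pos.2 (by positivity)
  have hsq : Real.sqrt (t / 2) ^ 2 = t / 2 := Real.sq_sqrt (by positivity)
  have hcs : (c * Real.sqrt (t / 2)) ^ 2 ≤ c ^ 2 * t := by
    rw [mul_pow, hsq]; gcongr; linarith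
  have h2 := h₁ Λ c hc A B hA hB U V hU hV _ hs
    (le_of_sq_le_sq (hcs.trans htc) hδ₁.le)
  have h3 : expUnitary (halfComm w A B) t =
      w * expUnitary (commSkew A B) (Real.sqrt (t / 2) ^ 2) * w⁻¹ := by
    rw [← expUnitary_conjSkew, hsq]
    refine Subtype.ext ?_
    rw [coe_expUnitary, coe_expUnitary, halfComm, skewAdjoint.val_smul, smul_smul]
    congr 2
    ring
  rw [h3, hW]
  refine ((norm_conj_sub_conj_le _ _ _).trans h2).trans ?_
  have h4 : (c * Real.sqrt (t / 2)) ^ m ≤ (c ^ 2 * t) ^ (m / 2) := by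
    calc _ = ((c * Real.sqrt (t / 2)) ^ 2) ^ (m / 2) := by
          rw [← Real.rpow_natCast, ← Real.rpow_mul (by positivity)]
          congr 1
          push_cast; ring
      _ ≤ _ := Real.rpow_le_rpow (by positivity) hcs (by positivity)
  exact mul_le_mul (le_abs_self _) h4 (by positivity) (abs_nonneg _)

end Noisy

/-! ### The generators of the ideal gates -/

section Generator

variable {Λ : ℕ}

theorem annihilation_apply (m n : Fin (Λ + 1)) :
    annihilation Λ m n = if (m : ℕ) + 1 = (n : ℕ) then ((Real.sqrt (n : ℕ) : ℝ) : ℂ) else 0 := rfl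

theorem sqrt_natCast_mul_self (n : ℕ) :
    ((Real.sqrt n : ℝ) : ℂ) * ((Real.sqrt n : ℝ) : ℂ) = n := by
  rw [← Complex.ofReal_mul, Real.mul_self_sqrt (Nat.cast_nonneg n), Complex.ofReal_natCast]

theorem annihilation_star_mul (Λ : ℕ) :
    (annihilation Λ)ᴴ * annihilation Λ =
      Matrix.diagonal fun n : Fin (Λ + 1) => ((n : ℕ) : ℂ) := by
  ext m n
  rw [Matrix.mul_apply, Matrix.diagonal_apply]
  simp only [Matrix.conjTranspose_apply, annihilation_apply]
  split_ifs with h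
  · subst h
    by_cases hm : (m : ℕ) = 0
    · simp [hm]
    · rw [Finset.sum_eq_single ⟨(m : ℕ) - 1, by omega⟩]
      · simp [Nat.sub_add_cancel (Nat.one_le_iff_ne_zero.2 hm), sqrt_natCast_mul_self]
      · intro j _ hj
        rw [if_neg (fun hjm => hj (Fin.ext (by simp; omega)))]
        simp
      · simp
  · refine Finset.sum_eq_zero fun j _ => ?_
    by_cases hm : (j : ℕ) + 1 = m
    · rw [if_neg (fun hn => h (Fin.ext (hm.symm.trans hn))), mul_zero]
    · rw [if_neg hm, star_zero, zero_mul]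

/-- The cutoff makes the top entry 0 instead of Λ + 1, so Λ bounds this product as well as the
number operator. -/
theorem annihilation_mul_star (Λ : ℕ) :
    annihilation Λ * (annihilation Λ)ᴴ =
      Matrix.diagonal fun n : Fin (Λ + 1) => if (n : ℕ) = Λ then 0 else ((n : ℕ) : ℂ) + 1 := by
  ext m n
  rw [Matrix.mul_apply, Matrix.diagonal_apply]
  simp only [Matrix.conjTranspose_apply, annihilation_apply]
  split_ifs with h hm
  · refine Finset.sum_eq_zero fun j _ => ?_
    rw [if_neg (by omega), zero_mul]
  · subst h
    rw [Finset.sum_eq_single ⟨(m : ℕ) + 1, by omega⟩]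
    · simpa using sqrt_natCast_mul_self ((m : ℕ) + 1)
    · intro j _ hj
      rw [if_neg (fun hjm => hj (Fin.ext (by simp; omega))), zero_mul]
    · simp
  · refine Finset.sum_eq_zero fun j _ => ?_
    by_cases hm : (m : ℕ) + 1 = j
    · rw [if_neg (fun hn : (n : ℕ) + 1 = j => h (Fin.ext (by omega))), star_zero, mul_zero]
    · rw [if_neg hm, zero_mul]

theorem norm_annihilation_blocks_le (Λ : ℕ) :
    ‖(Matrix.fromBlocks (annihilation Λ) 0 0 (annihilation Λ)ᴴ : Op Λ)‖ ≤ Real.sqrt Λ := by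
  refine Real.le_sqrt_of_sq_le ?_
  rw [sq, ← CStarRing.norm_star_mul_self, Matrix.star_eq_conjTranspose,
    Matrix.fromBlocks_conjTranspose, Matrix.fromBlocks_multiply]
  simp only [Matrix.conjTranspose_zero, Matrix.conjTranspose_conjTranspose, zero_mul, mul_zero,
    add_zero, zero_add, annihilation_star_mul, annihilation_mul_star, Matrix.fromBlocks_diagonal]
  rw [Matrix.l2_opNorm_diagonal, pi_norm_le_iff_of_nonneg (Nat.cast_nonneg _)]
  rintro (n | n)
  · simpa using n.is_le
  · simp only [Sum.elim_inr]
    split_ifs with h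
    · simp
    · rw [← Nat.cast_add_one, Complex.norm_natCast, Nat.cast_le]
      have := n.is_le
      omega

/-- The Hermitian generator of the ideal gate. -/
def generator (Λ k : ℕ) : Op Λ :=
  Matrix.fromBlocks 0 ((annihilation Λ)ᴴ ^ k) (annihilation Λ ^ k) 0

theorem fromBlocks_diag_pow (a b : Matrix (Fin (Λ + 1)) (Fin (Λ + 1)) ℂ) (k : ℕ) :
    (Matrix.fromBlocks a 0 0 b : Op Λ) ^ k = Matrix.fromBlocks (a ^ k) 0 0 (b ^ k) := by
  induction k with
  | zero => simp [Matrix.fromBlocks_one]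
  | succ k ih => simp [pow_succ, ih, Matrix.fromBlocks_multiply]

/-- The generator is the unitary X times the k-th power of diag(a, a†), whose norm is at most √Λ. -/
theorem norm_generator_le (Λ k : ℕ) : ‖generator Λ k‖ ≤ Real.sqrt Λ ^ k := by
  have h : generator Λ k = (Gate.pauliX.evalU (fun _ => (1 : UOp Λ)) (fun _ => 1) : Op Λ) *
      (Matrix.fromBlocks (annihilation Λ) 0 0 (annihilation Λ)ᴴ : Op Λ) ^ k := by
    simp [generator, Gate.evalU, fromBlocks_diag_pow, Matrix.fromBlocks_multiply]
  rw [h, CStarRing.norm_coe_unitary_mul]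
  exact (norm_pow_le _ _).trans (pow_le_pow_left₀ (norm_nonneg _) (norm_annihilation_blocks_le Λ) k)

/-- The skew-adjoint generator of the ideal gate. -/
def skewGenerator (Λ k : ℕ) : skewAdjoint (Op Λ) :=
  ⟨Complex.I • generator Λ k, by
    rw [skewAdjoint.mem_iff, star_smul, generator, Matrix.star_eq_conjTranspose,
      Matrix.fromBlocks_conjTranspose]
    simp [Matrix.conjTranspose_pow]⟩

theorem coe_skewGenerator (Λ k : ℕ) :
    (skewGenerator Λ k : Op Λ) = Complex.I • generator Λ k := rfl

theorem idealS_eq (Λ k : ℕ) (t : ℝ) : idealS Λ k t = expUnitary (skewGenerator Λ k) t := by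
  rw [coe_expUnitary, coe_skewGenerator, idealS, generator, mul_comm, mul_smul]
  rfl

theorem norm_skewGenerator_le {Λ k : ℕ} {e c : ℝ} (hΛ : 1 ≤ Λ) (hk : (k : ℝ) ≤ e)
    (hc : (Λ : ℝ) ^ (e / 2) ≤ c) : ‖(skewGenerator Λ k : Op Λ)‖ ≤ c := by
  have hΛ' : (1 : ℝ) ≤ Λ := by exact_mod_cast hΛ
  rw [coe_skewGenerator, norm_smul, Complex.norm_I, one_mul]
  refine (norm_generator_le Λ k).trans (le_trans ?_ hc)
  rw [Real.sqrt_eq_rpow, ← Real.rpow_natCast, ← Real.rpow_mul (by positivity)]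
  exact Real.rpow_le_rpow_of_exponent_le hΛ' (by linarith)

/-- The two commutators that ADD implements combine to the generator of the sum of the powers. -/
theorem conjSkew_add_halfComm (Ul Ur : ℝ → UOp Λ) (k l : ℕ) :
    conjSkew (Gate.pauliX.evalU Ul Ur)
      (halfComm (Gate.phase.evalU Ul Ur * Gate.hadamard.evalU Ul Ur)
        (conjSkew (Gate.pauliX.evalU Ul Ur) (skewGenerator Λ l)) (skewGenerator Λ k) +
      halfComm (Gate.hadamard.evalU Ul Ur)
        (conjSkew (Gate.phase.evalU Ul Ur) (skewGenerator Λ k))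
        (conjSkew (Gate.pauliX.evalU Ul Ur) (skewGenerator Λ l))) = skewGenerator Λ (k + l) := by
  have hX : (Gate.pauliX.evalU Ul Ur)⁻¹ = Gate.pauliX.evalU Ul Ur := (Gate.evalU_inv _ _ _).symm
  have hH : (Gate.hadamard.evalU Ul Ur)⁻¹ = Gate.hadamard.evalU Ul Ur :=
    (Gate.evalU_inv _ _ _).symm
  have hS : (Gate.phase.evalU Ul Ur)⁻¹ = Gate.phaseInv.evalU Ul Ur := (Gate.evalU_inv _ _ _).symm
  refine Subtype.ext ?_
  have e1 : annihilation Λ ^ (k + l) = annihilation Λ ^ k * annihilation Λ ^ l := pow_add _ _ _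
  have e2 : annihilation Λ ^ l * annihilation Λ ^ k = annihilation Λ ^ k * annihilation Λ ^ l := by
    rw [← pow_add, ← pow_add, add_comm l k]
  have e3 : (annihilation Λ)ᴴ ^ (k + l) = (annihilation Λ)ᴴ ^ k * (annihilation Λ)ᴴ ^ l :=
    pow_add _ _ _
  have e4 : (annihilation Λ)ᴴ ^ l * (annihilation Λ)ᴴ ^ k =
      (annihilation Λ)ᴴ ^ k * (annihilation Λ)ᴴ ^ l := by
    rw [← pow_add, ← pow_add, add_comm l k]
  -- The qubit gates are kept opaque: only their conjugation action on 2 × 2 blocks enters the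
  -- computation.
  obtain ⟨X, cX, bX⟩ : ∃ X : Op Λ,
      (∀ x, (conjSkew (Gate.pauliX.evalU Ul Ur) x : Op Λ) = X * x * X) ∧
      ∀ a b c d, X * Matrix.fromBlocks a b c d * X = Matrix.fromBlocks d c b a :=
    ⟨_, fun x => by rw [coe_conjSkew, hX]; rfl, fromBlocks_pauliX_conj⟩
  obtain ⟨S, S', cS, bS⟩ : ∃ S S' : Op Λ,
      (∀ x, (conjSkew (Gate.phase.evalU Ul Ur) x : Op Λ) = S * x * S') ∧
      ∀ a b c d, S * Matrix.fromBlocks a b c d * S' =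
        Matrix.fromBlocks a (-Complex.I • b) (Complex.I • c) d :=
    ⟨_, _, fun x => by rw [coe_conjSkew, hS]; rfl, fromBlocks_phase_conj⟩
  obtain ⟨H, cH, bH⟩ : ∃ H : Op Λ,
      (∀ x, (conjSkew (Gate.hadamard.evalU Ul Ur) x : Op Λ) = H * x * H) ∧
      ∀ a b c d, H * Matrix.fromBlocks a b c d * H = (1 / 2 : ℂ) •
        Matrix.fromBlocks (a + b + c + d) (a - b + c - d) (a + b - c - d) (a - b - c + d) :=
    ⟨_, fun x => by rw [coe_conjSkew, hH]; rfl, fromBlocks_hadamard_conj⟩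
  have cSH (x : skewAdjoint (Op Λ)) :
      (conjSkew (Gate.phase.evalU Ul Ur * Gate.hadamard.evalU Ul Ur) x : Op Λ) =
      conjSkew (Gate.phase.evalU Ul Ur) (conjSkew (Gate.hadamard.evalU Ul Ur) x) := by
    simp only [coe_conjSkew, mul_inv_rev, Submonoid.coe_mul, mul_assoc]
  have smul_blocks (a b c d : Matrix (Fin (Λ + 1)) (Fin (Λ + 1)) ℂ) (z : ℂ) :
      z • (Matrix.fromBlocks a b c d : Op Λ) =
      Matrix.fromBlocks (z • a) (z • b) (z • c) (z • d) := Matrix.fromBlocks_smul _ _ _ _ _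
  have sub_blocks (a b c d a' b' c' d' : Matrix (Fin (Λ + 1)) (Fin (Λ + 1)) ℂ) :
      (Matrix.fromBlocks a b c d - Matrix.fromBlocks a' b' c' d' : Op Λ) =
      Matrix.fromBlocks (a - a') (b - b') (c - c') (d - d') := by
    ext (i | i) (j | j) <;> rfl
  have half (x : Op Λ) : (1 / 2 : ℝ) • x = (1 / 2 : ℂ) • x := by
    ext i j
    simp
  rw [cX, AddSubgroup.coe_add, halfComm, halfComm, skewAdjoint.val_smul, skewAdjoint.val_smul,
    cSH, cS, cH, cH, coe_commSkew, coe_commSkew, cX, cS, coe_skewGenerator, coe_skewGenerator,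
    coe_skewGenerator, generator, generator, generator, half, half]
  simp only [smul_blocks, bX, bS, bH, Matrix.fromBlocks_multiply, sub_blocks, Matrix.fromBlocks_add,
    mul_zero, zero_mul, smul_zero, add_zero, zero_add, sub_zero, smul_mul_smul_comm, e1, e3]
  congr 1
  all_goals
    simp only [smul_smul, smul_mul_assoc, mul_smul_comm, e2, e4, mul_neg, neg_mul, Complex.I_mul_I]
    module

end Generator

/-! ### The algorithm ADD -/

section Add

/-- This is what the choice of q is for: the intrinsic error of the commutator formula, of order 2q
+ 1, does not dominate the noise. -/
theorem min_le_addOrder (pl pr : ℝ) : min pl pr ≤ 2 * (addOrder pl pr : ℝ) + 1 := by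
  have h1 := Nat.le_ceil ((min pl pr - 1) / 2)
  have h2 : ((⌈(min pl pr - 1) / 2⌉₊ : ℕ) : ℝ) ≤ addOrder pl pr := by
    exact_mod_cast le_max_left _ _
  linarith

theorem evalU_callFor_left {Λ : ℕ} (Ul Ur : ℝ → UOp Λ) (θ : ℝ) :
    (callFor .left θ).evalU Ul Ur = if 0 ≤ θ then Ul θ else (Ul (-θ))⁻¹ := by
  unfold callFor
  split_ifs <;> exact Circuit.evalU_singleton Ul Ur _

theorem evalU_callFor_right {Λ : ℕ} (Ul Ur : ℝ → UOp Λ) (θ : ℝ) :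
    (callFor .right θ).evalU Ul Ur = if 0 ≤ θ then Ur θ else (Ur (-θ))⁻¹ := by
  unfold callFor
  split_ifs <;> exact Circuit.evalU_singleton Ul Ur _

theorem close_of_rpow {Λ k : ℕ} {K δ c m p : ℝ} (hK : 0 < K) (hc : 0 < c) (hm : m ≤ p)
    {U : ℝ → UOp Λ}
    (h : ∀ t : ℝ, 0 < t → c * t ≤ δ → ‖(U t : Op Λ) - idealS Λ k t‖ ≤ K * (c * t) ^ p) :
    Close m c K (min δ 1) (fun t => if 0 ≤ t then U t else (U (-t))⁻¹)
      (expUnitary (skewGenerator Λ k)) := by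
  refine close_extend fun t ht htc => ?_
  rw [← idealS_eq]
  rw [le_min_iff] at htc
  refine (h t ht htc.1).trans (mul_le_mul_of_nonneg_left ?_ hK.le)
  exact Real.rpow_le_rpow_of_exponent_ge (mul_pos hc ht) htc.2 hm

theorem exists_bound_addCircuit (pl pr : ℝ) (hpl : 1 ≤ pl) (hpr : 1 ≤ pr) (K δ : ℝ) (hK : 0 < K)
    (hδ : 0 < δ) :
    ∃ K' δ' : ℝ, 0 < δ' ∧
      ∀ (Λ kl kr : ℕ) (c : ℝ), 1 ≤ Λ → (Λ : ℝ) ^ (((max kl kr : ℕ) : ℝ) / 2) ≤ c →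
      ∀ Sl Sr : ℝ → UOp Λ,
        (∀ t : ℝ, 0 < t → c * t ≤ δ → ‖(Sl t : Op Λ) - idealS Λ kl t‖ ≤ K * (c * t) ^ pl) →
        (∀ t : ℝ, 0 < t → c * t ≤ δ → ‖(Sr t : Op Λ) - idealS Λ kr t‖ ≤ K * (c * t) ^ pr) →
        ∀ t : ℝ, 0 < t → c ^ 2 * t ≤ δ' →
          ‖(addCircuit pl pr t).eval Sl Sr - idealS Λ (kl + kr) t‖
            ≤ K' * (c ^ 2 * t) ^ (min pl pr / 2) := by
  obtain ⟨p, hp⟩ := Nat.exists_eq_succ_of_ne_zero (addOrder_pos pl pr).ne'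
  have hm := min_le_addOrder pl pr
  have hm0 : 0 ≤ min pl pr := le_min (by linarith) (by linarith)
  set m := min pl pr with hmdef
  have hm1 : m ≤ ((2 * (p + 1) + 1 : ℕ) : ℝ) := by
    rw [hp] at hm; push_cast at hm ⊢; exact hm
  obtain ⟨K₁, δ₁, hδ₁, h₁⟩ := exists_close_halfComm m K (min δ 1) (by positivity) hm0 p hm1
  -- The Trotter stage only has to preserve order m/2, well below its own order 2q + 1.
  obtain ⟨K₂, δ₂, hδ₂, h₂⟩ := exists_bound_trotterGroup (m / 2) K₁ δ₁ hδ₁ p (by linarith)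
  refine ⟨K₂, δ₂, hδ₂, fun Λ kl kr c hΛ hc Sl Sr hl hr t ht htc => ?_⟩
  have hc0 : 0 < c := lt_of_lt_of_le (Real.rpow_pos_of_pos (by exact_mod_cast hΛ) _) hc
  have nl : ‖(skewGenerator Λ kl : Op Λ)‖ ≤ c :=
    norm_skewGenerator_le hΛ (by exact_mod_cast le_max_left kl kr) hc
  have nr : ‖(skewGenerator Λ kr : Op Λ)‖ ≤ c :=
    norm_skewGenerator_le hΛ (by exact_mod_cast le_max_right kl kr) hc
  have cl := close_of_rpow hK hc0 (min_le_left pl pr) hl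
  have cr := close_of_rpow hK hc0 (min_le_right pl pr) hr
  simp only [← evalU_callFor_left Sl Sr] at cl
  simp only [← evalU_callFor_right Sl Sr] at cr
  set X := Gate.pauliX.evalU Sl Sr
  set S := Gate.phase.evalU Sl Sr
  set H := Gate.hadamard.evalU Sl Sr
  have hX : X⁻¹ = X := (Gate.evalU_inv _ _ _).symm
  have hH : H⁻¹ = H := (Gate.evalU_inv _ _ _).symm
  have hS : S⁻¹ = Gate.phaseInv.evalU Sl Sr := (Gate.evalU_inv _ _ _).symm
  have cr' := cr.conjSkew X
  have cl' := cl.conjSkew S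
  have nr' := (norm_conjSkew X (skewGenerator Λ kr)).le.trans nr
  have nl' := (norm_conjSkew S (skewGenerator Λ kl)).le.trans nl
  have closeL := h₁ Λ c hc0 _ _ nr' nl _ _ (fun s => (addLeft (p + 1) s).evalU Sl Sr) (S * H)
    cr' cl (fun s => by
      rw [addLeft, Circuit.evalU_append, Circuit.evalU_append, evalU_bch]
      simp only [Circuit.evalU_append, Circuit.evalU_singleton, mul_inv_rev, hX, hH, hS]
      simp [Circuit.evalU, X, S, H])
  have closeR := h₁ Λ c hc0 _ _ nl' nr' _ _ (fun s => (addRight (p + 1) s).evalU Sl Sr) H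
    cl' cr' (fun s => by
      rw [addRight, Circuit.evalU_append, Circuit.evalU_append, evalU_bch]
      simp only [Circuit.evalU_append, Circuit.evalU_singleton, hX, hH, hS]
      rfl)
  simp only [← evalU_extendByInverse] at closeL closeR
  have bound := h₂ Λ (c ^ 2) (by positivity) _ _ (norm_halfComm_le (S * H) nr' nl)
    (norm_halfComm_le H nl' nr') _ _ closeL closeR t ht htc
  rw [← evalU_trotter] at bound
  refine le_trans ?_ ((norm_conj_sub_conj_le X _ _).trans bound)
  rw [← expUnitary_conjSkew, conjSkew_add_halfComm, ← idealS_eq, ← Circuit.coe_evalU, addCircuit,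
    hp, Circuit.evalU_append, Circuit.evalU_append, Circuit.evalU_singleton, hX]

end Add

end HybridAdder

end

theorem mainTheorem12 (pl pr : ℝ) (hpl : 1 ≤ pl) (hpr : 1 ≤ pr) :
    (∀ t : ℝ, 0 < t →
      ((HybridAdder.addCircuit pl pr t).numCalls : ℝ)
        ≤ 1.07 * 30 ^ HybridAdder.addOrder pl pr) ∧
    ∀ K δ : ℝ, 0 < K → 0 < δ → ∃ K' δ' : ℝ, 0 < K' ∧ 0 < δ' ∧
      ∀ (Λ kl kr : ℕ) (c : ℝ), 1 ≤ Λ → (Λ : ℝ) ^ (((max kl kr : ℕ) : ℝ) / 2) ≤ c →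
      ∀ Sl Sr : ℝ → Matrix.unitaryGroup (Fin (Λ + 1) ⊕ Fin (Λ + 1)) ℂ,
        (∀ t : ℝ, 0 < t → c * t ≤ δ →
          ‖(Sl t : HybridAdder.Op Λ) - HybridAdder.idealS Λ kl t‖ ≤ K * (c * t) ^ pl) →
        (∀ t : ℝ, 0 < t → c * t ≤ δ →
          ‖(Sr t : HybridAdder.Op Λ) - HybridAdder.idealS Λ kr t‖ ≤ K * (c * t) ^ pr) →
        ∀ t : ℝ, 0 < t → c ^ 2 * t ≤ δ' →
          ‖(HybridAdder.addCircuit pl pr t).eval Sl Sr - HybridAdder.idealS Λ (kl + kr) t‖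
            ≤ K' * (c ^ 2 * t) ^ (min pl pr / 2) := by
  refine ⟨fun t _ => ?_, fun K δ hK hδ => ?_⟩
  · rw [HybridAdder.numCalls_addCircuit]
    obtain ⟨p, hp⟩ := Nat.exists_eq_succ_of_ne_zero (HybridAdder.addOrder_pos pl pr).ne'
    rw [hp, Nat.succ_sub_one, Nat.succ_eq_add_one, pow_succ]
    push_cast
    have : (0 : ℝ) < 30 ^ p := by positivity
    -- The slack is large: 16 against 1.07 · 30 = 32.1.
    linarith
  · obtain ⟨K', δ', hδ', h⟩ := HybridAdder.exists_bound_addCircuit pl pr hpl hpr K δ hK hδ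
    -- The maximum with 1 only secures positivity, which the preceding bound does not assert.
    refine ⟨max K' 1, δ', by positivity, hδ', ?_⟩
    intro Λ kl kr c hΛ hc Sl Sr hl hr t ht htc
    refine (h Λ kl kr c hΛ hc Sl Sr hl hr t ht htc).trans ?_
    gcongr
    exact le_max_left _ _
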